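/- For $n\ge 1$ let $L_n$ be the lattice of partitions of $n$, i.e. of tuples $(a_1,\dots,a_n)$ of natural numbers with $a_1\ge a_2\ge\dots\ge a_n\ge 0$ and $a_1+\dots+a_n=n$, ordered by dominance: $\alpha\le\beta$ iff $\sum_{i\le j}a_i\le\sum_{i\le j}b_i$ for all $j$. Let $J(L_n)$ and $M(L_n)$ be its sets of join-irreducible and of meet-irreducible elements, and let $\mathbb K(L_n)=(J(L_n),M(L_n),\le)$ be its standard context. For a partition $\alpha$ of $k$ (put $a_i=0$ for $i>k$) say that $\alpha$ is in $\mathrm{Cl}(k)$ if $a_1-a_2\ge 2$; in $\mathrm{P}_l(k)$, $l\ge1$, if $a_1=\dots=a_{l+1}=a_{l+2}+1$; in $\mathrm{NP}(k)$ if $a_1=\dots=a_{l+1}\ge a_{l+2}+2$ for some $l\ge 1$; in $\mathrm{Ss}(k)$, respectively $\mathrm{NS}(k)$, if $(a_1-1,a_2,\dots)$ is a partition that has, respectively, the shape required in $\mathrm P_l$ for some $l\ge1$, or the shape required in $\mathrm{NP}$. Let $A^{\downarrow_i}$ be the set of all partitions obtained from members of $A$ by adding $1$ to the $i$-th entry.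 For a set $X$ of partitions of $k$ put $$\Phi_k(X)=(X\cap \mathrm{Cl}(k))^{\downarrow_1}\cup(X\cap \mathrm{NP}(k))^{\downarrow_1}\cup(X\cap \mathrm{Ss}(k))^{\downarrow_2}\cup(X\cap \mathrm{NS}(k))^{\downarrow_2}\cup\bigcup_{1\le l<k}(X\cap \mathrm P_l(k))^{\downarrow_{l+2}}\cup E_1(k+1)\cup E_2(k+1),$$ where $E_1(k+1)=\{(2,1,\dots,1)\}$ and $E_2(k+1)$ is the set of all partitions $(3,\dots,3,1,\dots,1)$ of $k+1$ with at least one $3$ and at least one $1$. The model of computation is a random access machine with unit cost for constants, register and memory accesses, truncated subtraction, addition, multiplication, comparison, tests, and writing one number to the output tape. On input $n$ its words hold the numbers $0,\dots,(n+2)^d$, where $d$ is a constant. A list of partitions is output as its length followed by the $n$-tuples $(a_1,\dots,a_n)$; $\mathbb K(L_n)$ is output as the list of objects, the list of attributes, and the cross table of $\le$ with one number ($0$ or $1$) per cell. In all lists each element occurs exactly once, and the order is arbitrary. (1) There are a constant $d$ and programs $\mathit{init}$, $\mathit{step}$, $\mathit{out}_J$, $\mathit{out}_K$ such that the following holds.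 - On every input $n\ge1$, $\mathit{init}$ stores a list of $J(L_{k})$ for $k=\min(n,3)$ in constant time. - Whenever $3\le k<n$ and a list of a set $X\subseteq J(L_k)$ is stored, $\mathit{step}$ replaces it by a list of $\Phi_k(X)$ in time $O(k^2)$. (Stored partitions are run-length coded: each of the at most three distinct positive parts is stored with its multiplicity.) - The program "$\mathit{init}$; while $k<n$ do $\mathit{step}$; $\mathit{out}_J$" outputs $J(L_n)$ for every $n\ge1$, and its running time is $\Theta(n^3)$. - The program "$\mathit{init}$; while $k<n$ do $\mathit{step}$; $\mathit{out}_K$" outputs $\mathbb K(L_n)$ for every $n\ge 1$, and its running time is $\Theta(n^4)$. (2) This is near-optimal: there is a constant $c>0$ such that for all sufficiently large $n$, every program, with any word size, that on input $n$ halts with output $\mathbb K(L_n)$ takes at least $c\,n^4$ steps. -/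

import Mathlib

open Filter Asymptotics

/-! ## The lattice of integer partitions -/

/-- A partition of `n`: a tuple `a₁ ≥ a₂ ≥ … ≥ aₙ ≥ 0` with sum `n`, continued by zeros.
Indices are shifted by one: the `i`-th entry `aᵢ` is `part (i - 1)`. -/
@[ext]
structure Ptn (n : ℕ) where
  part : ℕ → ℕ
  anti : Antitone part
  zero : ∀ i, n ≤ i → part i = 0
  sum_eq : ∑ i ∈ Finset.range n, part i = n

namespace Ptn

/-- The sum of the first `j` entries. -/
def pre {n : ℕ} (α : Ptn n) (j : ℕ) : ℕ := ∑ i ∈ Finset.range j, α.part i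

theorem pre_zero {n : ℕ} (α : Ptn n) : α.pre 0 = 0 := by simp [pre]

theorem pre_succ {n : ℕ} (α : Ptn n) (j : ℕ) : α.pre (j + 1) = α.pre j + α.part j :=
  Finset.sum_range_succ _ _

theorem pre_mono {n : ℕ} (α : Ptn n) : Monotone α.pre :=
  monotone_nat_of_le_succ fun j => by rw [pre_succ]; omega

theorem pre_of_le {n : ℕ} (α : Ptn n) {j : ℕ} (h : n ≤ j) : α.pre j = n := by
  induction j, h using Nat.le_induction with
  | base => exact α.sum_eq
  | succ j hj ih => rw [pre_succ, ih, α.zero j hj]; rfl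

theorem pre_concave {n : ℕ} (α : Ptn n) (j : ℕ) :
    α.pre j + α.pre (j + 2) ≤ 2 * α.pre (j + 1) := by
  have h1 := α.pre_succ j
  have h2 := α.pre_succ (j + 1)
  have h3 := α.anti (Nat.le_succ j)
  have h4 : j + 1 + 1 = j + 2 := rfl
  simp only [Nat.succ_eq_add_one] at h3
  rw [h4] at h2
  omega

theorem pre_injective {n : ℕ} : Function.Injective (pre : Ptn n → ℕ → ℕ) := by
  intro α β h
  ext j
  have h1 := α.pre_succ j
  have h2 := β.pre_succ j
  rw [h] at h1
  omega

/-- The dominance ordering: all partial sums are compared. -/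
instance (n : ℕ) : PartialOrder (Ptn n) := PartialOrder.lift pre pre_injective

theorem le_iff {n : ℕ} {α β : Ptn n} : α ≤ β ↔ ∀ j, α.pre j ≤ β.pre j := Iff.rfl

/-- A partition from its sequence of partial sums. -/
def ofPre {n : ℕ} (P : ℕ → ℕ) (h0 : P 0 = 0) (hm : Monotone P)
    (hc : ∀ j, P j + P (j + 2) ≤ 2 * P (j + 1)) (hn : ∀ j, n ≤ j → P j = n) : Ptn n where
  part i := P (i + 1) - P i
  anti := antitone_nat_of_succ_le fun j => by
    have h1 := hc j
    have h2 := hm (Nat.le_succ j)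
    have h3 : P (j + 1 + 1) = P (j + 2) := rfl
    simp only [Nat.succ_eq_add_one] at h2
    omega
  zero i hi := by rw [hn i hi, hn (i + 1) (by omega)]; omega
  sum_eq := by rw [Finset.sum_range_tsub hm, h0, hn n le_rfl]; rfl

theorem pre_ofPre {n : ℕ} (P : ℕ → ℕ) (h0 : P 0 = 0) (hm : Monotone P)
    (hc : ∀ j, P j + P (j + 2) ≤ 2 * P (j + 1)) (hn : ∀ j, n ≤ j → P j = n) (j : ℕ) :
    (ofPre P h0 hm hc hn).pre j = P j := by
  change ∑ i ∈ Finset.range j, (P (i + 1) - P i) = P j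
  rw [Finset.sum_range_tsub hm, h0]; rfl

/-- The partition `(n)`. -/
def single (n : ℕ) : Ptn n :=
  ofPre (fun j => if j = 0 then 0 else n) (by simp)
    (monotone_nat_of_le_succ fun j => by by_cases h : j = 0 <;> simp [h])
    (fun j => by by_cases h : j = 0 <;> simp [h] <;> omega)
    (fun j hj => by by_cases h : j = 0 <;> simp [h] <;> omega)

theorem le_single {n : ℕ} (α : Ptn n) : α ≤ single n := by
  intro j
  change α.pre j ≤ (single n).pre j
  rw [single, pre_ofPre]
  by_cases h : j = 0
  · simp [h, pre_zero]
  · simp only [h, if_false]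
    calc α.pre j ≤ α.pre (max j n) := α.pre_mono (le_max_left _ _)
      _ = n := α.pre_of_le (le_max_right _ _)

/-- The pointwise infimum of the partial sums over `S` (and the top element `(n)`). -/
noncomputable def infPre {n : ℕ} (S : Set (Ptn n)) (j : ℕ) : ℕ :=
  sInf ((fun α : Ptn n => α.pre j) '' insert (single n) S)

theorem infPre_le {n : ℕ} {S : Set (Ptn n)} {α : Ptn n} (h : α ∈ insert (single n) S) (j : ℕ) :
    infPre S j ≤ α.pre j := Nat.sInf_le ⟨α, h, rfl⟩

theorem exists_infPre {n : ℕ} (S : Set (Ptn n)) (j : ℕ) :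
    ∃ α ∈ insert (single n) S, α.pre j = infPre S j :=
  Nat.sInf_mem (⟨_, single n, Set.mem_insert _ _, rfl⟩ :
    ((fun α : Ptn n => α.pre j) '' insert (single n) S).Nonempty)

noncomputable instance (n : ℕ) : InfSet (Ptn n) where
  sInf S := ofPre (infPre S)
    (by obtain ⟨α, _, h⟩ := exists_infPre S 0; rw [← h, pre_zero])
    (fun i j hij => by
      obtain ⟨α, hα, h⟩ := exists_infPre S j
      rw [← h]
      exact (infPre_le hα i).trans (α.pre_mono hij))
    (fun j => by
      obtain ⟨α, hα, h⟩ := exists_infPre S (j + 1)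
      rw [← h]
      exact (add_le_add (infPre_le hα _) (infPre_le hα _)).trans (α.pre_concave j))
    (fun j hj => by obtain ⟨α, _, h⟩ := exists_infPre S j; rw [← h, α.pre_of_le hj])

/-- The lattice `Lₙ` of all partitions of `n` with the dominance ordering. -/
noncomputable instance (n : ℕ) : CompleteLattice (Ptn n) :=
  completeLatticeOfInf (Ptn n) fun S => by
    refine ⟨fun α hα j => ?_, fun β hβ j => ?_⟩
    · exact (pre_ofPre _ _ _ _ _ j).trans_le (infPre_le (Set.mem_insert_of_mem _ hα) j)
    · refine le_trans ?_ (pre_ofPre _ _ _ _ _ j).ge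
      obtain ⟨α, hα, h⟩ := exists_infPre S j
      rw [← h]
      rcases hα with rfl | hα
      · exact le_single β j
      · exact hβ hα j

/-- The set `J(Lₙ)` of join-irreducible elements (the objects of the standard context). -/
def J (n : ℕ) : Set (Ptn n) := {α | SupIrred α}

/-- The set `M(Lₙ)` of meet-irreducible elements (the attributes of the standard context). -/
def M (n : ℕ) : Set (Ptn n) := {α | InfIrred α}

/-! ## The recursion from `J(Lₙ)` to `J(Lₙ₊₁)` -/

/-- Cliff at the first column: `a₁ - a₂ ≥ 2`. -/
def Cl (a : ℕ → ℕ) : Prop := a 1 + 2 ≤ a 0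

/-- Slippery plateau of length `l` at the first column:
`a₁ = a₂ = … = a_{l+1}` and `a_{l+1} - a_{l+2} = 1`. -/
def PP (l : ℕ) (a : ℕ → ℕ) : Prop := 1 ≤ l ∧ (∀ i < l, a i = a (i + 1)) ∧ a l = a (l + 1) + 1

/-- Non-slippery plateau (of some length `l ≥ 1`) at the first column:
`a₁ = a₂ = … = a_{l+1}` and `a_{l+1} - a_{l+2} ≥ 2`. -/
def NP (a : ℕ → ℕ) : Prop :=
  ∃ l, 1 ≤ l ∧ (∀ i < l, a i = a (i + 1)) ∧ a (l + 1) + 2 ≤ a l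

/-- The tuple with one grain removed from the first column. -/
def dropGrain (a : ℕ → ℕ) : ℕ → ℕ := Function.update a 0 (a 0 - 1)

/-- Slippery step at the first column: `(a₁ - 1, a₂, …)` is a partition with a slippery plateau
at the first column. -/
def Ss (a : ℕ → ℕ) : Prop := 1 ≤ a 0 ∧ Antitone (dropGrain a) ∧ ∃ l, PP l (dropGrain a)

/-- Non-slippery step at the first column. -/
def NS (a : ℕ → ℕ) : Prop := 1 ≤ a 0 ∧ Antitone (dropGrain a) ∧ NP (dropGrain a)

/-- One grain is added to column `i + 1` (position `i` when counting from zero). -/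
def addGrain (i : ℕ) (a : ℕ → ℕ) : ℕ → ℕ := Function.update a i (a i + 1)

/-- `A^{↓ i + 1}`: the partitions of `n + 1` that arise from members of `A` by adding one grain to
column `i + 1`. -/
def down {n : ℕ} (A : Set (Ptn n)) (i : ℕ) : Set (Ptn (n + 1)) :=
  {β | ∃ α ∈ A, β.part = addGrain i α.part}

/-- The exceptional set `{(2, 1, …, 1)}`. -/
def E₁ (k : ℕ) : Set (Ptn k) :=
  {β | β.part 0 = 2 ∧ ∀ i, 1 ≤ i → β.part i ≤ 1}

/-- The exceptional set of all `(3, …, 3, 1, …, 1)` with `m ≥ 1` threes and `l ≥ 1` ones. -/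
def E₂ (k : ℕ) : Set (Ptn k) :=
  {β | ∃ m l, 1 ≤ m ∧ 1 ≤ l ∧ (∀ i < m, β.part i = 3) ∧
    (∀ i, m ≤ i → i < m + l → β.part i = 1) ∧ ∀ i, m + l ≤ i → β.part i = 0}

/-- One step of the recursion. -/
def recStep (n : ℕ) (X : Set (Ptn n)) : Set (Ptn (n + 1)) :=
  down (X ∩ {α | Cl α.part}) 0 ∪ down (X ∩ {α | NP α.part}) 0 ∪
    down (X ∩ {α | Ss α.part}) 1 ∪ down (X ∩ {α | NS α.part}) 1 ∪
    (⋃ l ∈ Finset.Ico 1 n, down (X ∩ {α | PP l α.part}) (l + 1)) ∪ E₁ (n + 1) ∪ E₂ (n + 1)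

/-- `L` lists every element of `A` exactly once. -/
def Lists {n : ℕ} (L : List (Ptn n)) (A : Set (Ptn n)) : Prop :=
  L.Nodup ∧ ∀ α, α ∈ L ↔ α ∈ A

/-- How often the positive number `h` occurs in `α`. -/
def mult {n : ℕ} (α : Ptn n) (h : ℕ) : ℕ :=
  if h = 0 then 0 else ((Finset.range n).filter fun i => α.part i = h).card

/-- Run-length code of a partition: its three largest distinct positive parts in decreasing order,
each followed by its multiplicity; absent parts are coded by `0, 0`. (Join-irreducible partitions
have at most three distinct positive parts, so nothing is lost for them.) -/
def runs {n : ℕ} (α : Ptn n) : List ℕ :=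
  let h₁ := α.part 0
  let m₁ := α.mult h₁
  let h₂ := α.part m₁
  let m₂ := α.mult h₂
  let h₃ := α.part (m₁ + m₂)
  let m₃ := α.mult h₃
  [h₁, m₁, h₂, m₂, h₃, m₃]

/-- The `n`-tuple `(a₁, …, aₙ)`. -/
def tuple {n : ℕ} (α : Ptn n) : List ℕ := (List.range n).map α.part

end Ptn

/-! ## Random access machines with a step count -/

/-- Registers, memory, and a write-only output tape. -/
structure RamState where
  reg : ℕ → ℕ
  mem : ℕ → ℕ
  out : List ℕ

/-- Arithmetic expressions: constants, registers, indirect memory access, and the word operations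
(`sub` is truncated, `lt` yields `1` or `0`). -/
inductive RamExpr where
  | lit (c : ℕ)
  | reg (i : ℕ)
  | load (a : RamExpr)
  | add (a b : RamExpr)
  | sub (a b : RamExpr)
  | mul (a b : RamExpr)
  | lt (a b : RamExpr)

namespace RamExpr

def eval (s : RamState) : RamExpr → ℕ
  | lit c => c
  | reg i => s.reg i
  | load a => s.mem (a.eval s)
  | add a b => a.eval s + b.eval s
  | sub a b => a.eval s - b.eval s
  | mul a b => a.eval s * b.eval s
  | lt a b => if a.eval s < b.eval s then 1 else 0

/-- One unit of time for every constant, register access, memory access and operation. -/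
def cost : RamExpr → ℕ
  | lit _ => 1
  | reg _ => 1
  | load a => a.cost + 1
  | add a b => a.cost + b.cost + 1
  | sub a b => a.cost + b.cost + 1
  | mul a b => a.cost + b.cost + 1
  | lt a b => a.cost + b.cost + 1

/-- All values that occur in the evaluation are at most `W`, i.e. fit into a machine word. -/
def Fits (W : ℕ) (s : RamState) : RamExpr → Prop
  | lit c => c ≤ W
  | reg i => s.reg i ≤ W
  | load a => a.Fits W s ∧ s.mem (a.eval s) ≤ W
  | add a b => a.Fits W s ∧ b.Fits W s ∧ a.eval s + b.eval s ≤ W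
  | sub a b => a.Fits W s ∧ b.Fits W s
  | mul a b => a.Fits W s ∧ b.Fits W s ∧ a.eval s * b.eval s ≤ W
  | lt a b => a.Fits W s ∧ b.Fits W s ∧ 1 ≤ W

end RamExpr

/-- Programs. A program does not depend on the input. -/
inductive RamProg where
  | skip
  | assign (i : ℕ) (e : RamExpr)
  | store (a e : RamExpr)
  | emit (e : RamExpr)
  | seq (p q : RamProg)
  | ite (e : RamExpr) (p q : RamProg)
  | loop (e : RamExpr) (p : RamProg)

/-- `Exec W p s t s'`: with machine words holding the numbers `0, …, W`, the program `p` started in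
state `s` halts after exactly `t` time units in state `s'`. -/
inductive Exec (W : ℕ) : RamProg → RamState → ℕ → RamState → Prop where
  | skip (s : RamState) : Exec W .skip s 1 s
  | assign (i : ℕ) (e : RamExpr) (s : RamState) (h : e.Fits W s) :
      Exec W (.assign i e) s (e.cost + 1) { s with reg := Function.update s.reg i (e.eval s) }
  | store (a e : RamExpr) (s : RamState) (ha : a.Fits W s) (he : e.Fits W s) :
      Exec W (.store a e) s (a.cost + e.cost + 1)
        { s with mem := Function.update s.mem (a.eval s) (e.eval s) }
  | emit (e : RamExpr) (s : RamState) (h : e.Fits W s) :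
      Exec W (.emit e) s (e.cost + 1) { s with out := s.out ++ [e.eval s] }
  | seq {p q : RamProg} {s₁ s₂ s₃ : RamState} {t₁ t₂ : ℕ}
      (hp : Exec W p s₁ t₁ s₂) (hq : Exec W q s₂ t₂ s₃) : Exec W (.seq p q) s₁ (t₁ + t₂) s₃
  | ite_true {e : RamExpr} {p q : RamProg} {s s' : RamState} {t : ℕ} (h : e.Fits W s)
      (he : e.eval s ≠ 0) (hp : Exec W p s t s') : Exec W (.ite e p q) s (e.cost + 1 + t) s'
  | ite_false {e : RamExpr} {p q : RamProg} {s s' : RamState} {t : ℕ} (h : e.Fits W s)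
      (he : e.eval s = 0) (hq : Exec W q s t s') : Exec W (.ite e p q) s (e.cost + 1 + t) s'
  | loop_done {e : RamExpr} {p : RamProg} {s : RamState} (h : e.Fits W s) (he : e.eval s = 0) :
      Exec W (.loop e p) s (e.cost + 1) s
  | loop_step {e : RamExpr} {p : RamProg} {s₁ s₂ s₃ : RamState} {t₁ t₂ : ℕ} (h : e.Fits W s₁)
      (he : e.eval s₁ ≠ 0) (hp : Exec W p s₁ t₁ s₂) (hl : Exec W (.loop e p) s₂ t₂ s₃) :
      Exec W (.loop e p) s₁ (e.cost + 1 + t₁ + t₂) s₃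

/-- The initial state on input `n`: register `0` holds `n`, everything else is zero or empty. -/
def ramInput (n : ℕ) : RamState where
  reg := fun i => if i = 0 then n else 0
  mem := fun _ => 0
  out := []

/-- Words of `O(log n)` bits. -/
def wordBound (d n : ℕ) : ℕ := (n + 2) ^ d

/-! ## What the programs have to produce -/

open Ptn

/-- The machine holds the list `L` of partitions of `k` while working on input `n`: register `0`
is `n`, register `1` is `k`, register `2` is the length of `L`, nothing has been output yet, and the
memory from address `0` on contains the run-length codes of the members of `L`, six words each. -/
def Holds (n k : ℕ) (L : List (Ptn k)) (s : RamState) : Prop :=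
  s.reg 0 = n ∧ s.reg 1 = k ∧ s.reg 2 = L.length ∧ s.out = [] ∧
    ∀ (i : ℕ) (hi : i < L.length) (j : ℕ), j < 6 → s.mem (6 * i + j) = (L[i].runs).getD j 0

/-- The output `o` is a list of `J(Lₙ)`: the number of its elements, then the elements themselves
as `n`-tuples, in some order. -/
def IsJOutput (n : ℕ) (o : List ℕ) : Prop :=
  ∃ L : List (Ptn n), Lists L (J n) ∧ o = L.length :: L.flatMap tuple

open Classical in
/-- The cross table of `≤` between the objects `G` and the attributes `A`, row by row: `1` for a
cross, `0` for an empty cell. -/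
noncomputable def crossTable {n : ℕ} (G A : List (Ptn n)) : List ℕ :=
  G.flatMap fun α => A.map fun β => if α ≤ β then 1 else 0

/-- The output `o` is the standard context `K(Lₙ) = (J(Lₙ), M(Lₙ), ≤)`: the list of its objects,
the list of its attributes, and its cross table. -/
def IsContextOutput (n : ℕ) (o : List ℕ) : Prop :=
  ∃ G A : List (Ptn n), Lists G (J n) ∧ Lists A (M n) ∧
    o = (G.length :: G.flatMap tuple) ++ (A.length :: A.flatMap tuple) ++ crossTable G A

/-- `init` prepares, in constant time, a list of `J(L_k)` for the initial value `k = min n 3`. -/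
def IsInit (d c : ℕ) (init : RamProg) : Prop :=
  ∀ n, 1 ≤ n → ∃ (L : List (Ptn (min n 3))) (t : ℕ) (s : RamState),
    Lists L (J (min n 3)) ∧ Exec (wordBound d n) init (ramInput n) t s ∧ t ≤ c ∧
    Holds n (min n 3) L s

/-- `step` carries out one step of the recursion, in time `O(k²)`: it replaces a stored set `X` of
join-irreducible partitions of `k` by the set `recStep k X` of partitions of `k + 1`. -/
def IsRecStep (d c : ℕ) (step : RamProg) : Prop :=
  ∀ n k, 3 ≤ k → k < n → ∀ (X : Set (Ptn k)) (L : List (Ptn k)) (s : RamState),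
    X ⊆ J k → Lists L X → Holds n k L s →
    ∃ (L' : List (Ptn (k + 1))) (t : ℕ) (s' : RamState),
      Lists L' (recStep k X) ∧ Exec (wordBound d n) step s t s' ∧ t ≤ c * k ^ 2 ∧
      Holds n (k + 1) L' s'

/-- Initialise, iterate `step` while `k < n`, then produce the output from the stored list. -/
def iterProg (init step fin : RamProg) : RamProg :=
  .seq init (.seq (.loop (.lt (.reg 1) (.reg 0)) step) fin)

/-- On every input `n ≥ 1` the program `p` halts with an output satisfying `Good n`, and its
running time is `Θ(nᵉ)`. -/
def RunsInTheta (d : ℕ) (p : RamProg) (Good : ℕ → List ℕ → Prop) (e : ℕ) : Prop :=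
  ∃ T : ℕ → ℕ,
    (∀ n, 1 ≤ n → ∃ s, Exec (wordBound d n) p (ramInput n) (T n) s ∧ Good n s.out) ∧
    (fun n => (T n : ℝ)) =Θ[atTop] fun n => (n : ℝ) ^ e

/-! Everything rests on an explicit list of the join-irreducible partitions. Moving one grain to a
later column lowers the partial sums by one on an interval. A partition with two moves over disjoint
intervals, or over intervals that meet only at a step of height one, is the join of the two results.
This leaves four shapes with at most three runs (`exists_isJoin_of_supIrred`): `h…h` with `h ≥ 2`,
`h…h 1…1` with `h ≥ 3`, `(h+1)…(h+1) h…h` with `h ≥ 1`, and `(h+1)…(h+1) h…h 1…1` with `h ≥ 3`.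
Conversely, each of them has one move whose result lies above everything strictly smaller
(`supIrred_of_isJoin`).

On run-length codes the recursion is a single injective map `child`: the grain goes on column one if
the first run ends in a drop of at least two, and otherwise on the first column after that run. The
codes without a predecessor are those of `(2,1,…,1)` and `(3,…,3,1,…,1)` (`exists_child`). Hence
`recStep_J`, and a step creates no duplicates. A step adds `1 + k / 3` elements, so `J` has between
`k² / 12` and `k²` elements. Each record takes constant time, which makes a step quadratic and the
whole recursion cubic.

Conjugation reverses dominance, so the attributes are the conjugates of the objects and the same
records describe both. Partial sums of an object are linear on each run and those of any partition
are concave; thus a comparison needs only the ends of at most three runs (`le_iff_of_code`), and a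
cell of the cross table takes constant time.

All lower bounds come from the length of the output, since every emitted number costs time: about
`n²` tuples of length `n` for `J`, and at least `n⁴ / 144` cells for the context. -/

/-! ## Reasoning about programs -/

namespace RamProg

/-- An upper bound for the running time of a loop-free program. -/
def size : RamProg → ℕ
  | skip => 1
  | assign _ e => e.cost + 1
  | store a e => a.cost + e.cost + 1
  | emit e => e.cost + 1
  | seq p q => p.size + q.size
  | ite e p q => e.cost + 1 + p.size + q.size
  | loop e _ => e.cost + 1

/-- The weakest precondition of a loop-free program. -/
def Wp (W : ℕ) : RamProg → (RamState → Prop) → RamState → Prop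
  | skip, Q, s => Q s
  | assign i e, Q, s => e.Fits W s ∧ Q { s with reg := Function.update s.reg i (e.eval s) }
  | store a e, Q, s => a.Fits W s ∧ e.Fits W s ∧
      Q { s with mem := Function.update s.mem (a.eval s) (e.eval s) }
  | emit e, Q, s => e.Fits W s ∧ Q { s with out := s.out ++ [e.eval s] }
  | seq p q, Q, s => p.Wp W (q.Wp W Q) s
  | ite e p q, Q, s => e.Fits W s ∧ (e.eval s ≠ 0 → p.Wp W Q s) ∧ (e.eval s = 0 → q.Wp W Q s)
  | loop _ _, _, _ => False

/-- The program halts within `T` steps in a state that satisfies `Q`. -/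
def Runs (W : ℕ) (p : RamProg) (s : RamState) (T : ℕ) (Q : RamState → Prop) : Prop :=
  ∃ t s', Exec W p s t s' ∧ t ≤ T ∧ Q s'

theorem Wp.runs {W : ℕ} {p : RamProg} {Q : RamState → Prop} {s : RamState} (h : p.Wp W Q s) :
    p.Runs W s p.size Q := by
  induction p generalizing Q s with
  | skip => exact ⟨_, _, .skip s, le_rfl, h⟩
  | assign i e => exact ⟨_, _, .assign i e s h.1, le_rfl, h.2⟩
  | store a e => exact ⟨_, _, .store a e s h.1 h.2.1, le_rfl, h.2.2⟩
  | emit e => exact ⟨_, _, .emit e s h.1, le_rfl, h.2⟩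
  | seq p q hp hq =>
    obtain ⟨t₁, s₁, h₁, ht₁, k₁⟩ := hp h
    obtain ⟨t₂, s₂, h₂, ht₂, k₂⟩ := hq k₁
    exact ⟨_, _, .seq h₁ h₂, Nat.add_le_add ht₁ ht₂, k₂⟩
  | ite e p q hp hq =>
    obtain ⟨hf, h₁, h₂⟩ := h
    by_cases he : e.eval s = 0
    · obtain ⟨t, s', h, ht, k⟩ := hq (h₂ he)
      exact ⟨_, _, .ite_false hf he h, by simp only [size]; omega, k⟩
    · obtain ⟨t, s', h, ht, k⟩ := hp (h₁ he)
      exact ⟨_, _, .ite_true hf he h, by simp only [size]; omega, k⟩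
  | loop => exact h.elim

theorem Runs.mono {W : ℕ} {p : RamProg} {s : RamState} {T T' : ℕ} {Q Q' : RamState → Prop}
    (h : p.Runs W s T Q) (hT : T ≤ T') (hQ : ∀ s', Q s' → Q' s') : p.Runs W s T' Q' := by
  obtain ⟨t, s', h, ht, k⟩ := h
  exact ⟨t, s', h, ht.trans hT, hQ _ k⟩

theorem Runs.seq {W : ℕ} {p q : RamProg} {s : RamState} {T₁ T₂ : ℕ} {P Q : RamState → Prop}
    (hp : p.Runs W s T₁ P) (hq : ∀ s', P s' → q.Runs W s' T₂ Q) :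
    (p.seq q).Runs W s (T₁ + T₂) Q := by
  obtain ⟨t₁, s₁, h₁, ht₁, k₁⟩ := hp
  obtain ⟨t₂, s₂, h₂, ht₂, k₂⟩ := hq _ k₁
  exact ⟨_, _, .seq h₁ h₂, Nat.add_le_add ht₁ ht₂, k₂⟩

/-- A loop with invariant `I` that is executed `N` times. -/
theorem Runs.loop {W : ℕ} {e : RamExpr} {p : RamProg} (I : ℕ → RamState → Prop) (N T : ℕ)
    (hI : ∀ i, i < N → ∀ s, I i s → e.Fits W s ∧ e.eval s ≠ 0 ∧ p.Runs W s T (I (i + 1)))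
    (hN : ∀ s, I N s → e.Fits W s ∧ e.eval s = 0) {s : RamState} (hs : I 0 s) :
    (RamProg.loop e p).Runs W s (N * (e.cost + 1 + T) + (e.cost + 1)) (I N) := by
  -- Induction on the number `m` of remaining rounds, so that the invariant can advance with `i`.
  suffices H : ∀ m i, i + m = N → ∀ s, I i s →
      (RamProg.loop e p).Runs W s (m * (e.cost + 1 + T) + (e.cost + 1)) (I N) from
    H N 0 (Nat.zero_add N) s hs
  intro m
  induction m with
  | zero =>
    intro i hi s hs
    obtain rfl : i = N := hi
    obtain ⟨h₁, h₂⟩ := hN s hs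
    exact ⟨_, _, .loop_done h₁ h₂, by omega, hs⟩
  | succ m ih =>
    intro i hi s hs
    obtain ⟨h₁, h₂, t₁, s₁, h₃, ht₁, k₁⟩ := hI i (by omega) s hs
    obtain ⟨t₂, s₂, h₄, ht₂, k₂⟩ := ih (i + 1) (by omega) s₁ k₁
    exact ⟨_, _, .loop_step h₁ h₂ h₃ h₄, by rw [Nat.succ_mul]; omega, k₂⟩

/-- The program halts within `T` steps, outputs `l`, and changes neither the memory nor the
registers below `r`. -/
def Emits (W r : ℕ) (p : RamProg) (s : RamState) (T : ℕ) (l : List ℕ) : Prop :=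
  p.Runs W s T fun s' => s'.mem = s.mem ∧ s'.out = s.out ++ l ∧ ∀ i < r, s'.reg i = s.reg i

theorem emits_emit {W r : ℕ} {e : RamExpr} {s : RamState} (h : e.Fits W s) :
    (emit e).Emits W r s (e.cost + 1) [e.eval s] :=
  ⟨_, _, .emit e s h, le_rfl, rfl, rfl, fun _ _ => rfl⟩

theorem Emits.mono {W r r' : ℕ} {p : RamProg} {s : RamState} {T T' : ℕ} {l : List ℕ}
    (h : p.Emits W r s T l) (hr : r' ≤ r) (hT : T ≤ T') : p.Emits W r' s T' l :=
  Runs.mono h hT fun _ h => ⟨h.1, h.2.1, fun i hi => h.2.2 i (hi.trans_le hr)⟩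

/-- The second program must work from every state that agrees with `s` in memory and low registers,
because the scratch registers and the tape have changed by then. -/
theorem Emits.seq {W r : ℕ} {p q : RamProg} {s : RamState} {T₁ T₂ : ℕ} {l₁ l₂ : List ℕ}
    (hp : p.Emits W r s T₁ l₁)
    (hq : ∀ s' : RamState, s'.mem = s.mem → (∀ i < r, s'.reg i = s.reg i) →
      q.Emits W r s' T₂ l₂) :
    (p.seq q).Emits W r s (T₁ + T₂) (l₁ ++ l₂) := by
  refine Runs.seq hp fun s₁ h₁ => Runs.mono (hq s₁ h₁.1 h₁.2.2) le_rfl fun s₂ h₂ => ?_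
  refine ⟨h₂.1.trans h₁.1, ?_, fun i hi => (h₂.2.2 i hi).trans (h₁.2.2 i hi)⟩
  rw [h₂.2.1, h₁.2.1, List.append_assoc]

/-- Output the value of `v` as often as `m` says, with register `r` as counter. -/
def rep (r : ℕ) (m v : RamExpr) : RamProg :=
  .seq (.assign r m)
    (.loop (.lt (.lit 0) (.reg r)) (.seq (.emit v) (.assign r (.sub (.reg r) (.lit 1)))))

/-- `v` is evaluated afresh in each round; `hv` ensures that the counter in register `r` does not
disturb its value. -/
theorem emits_rep {W r : ℕ} {m v : RamExpr} {s : RamState} {M x : ℕ} (hW : 1 ≤ W)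
    (hm : m.Fits W s) (hM : m.eval s = M) (hMW : M ≤ W)
    (hv : ∀ s' : RamState, s'.mem = s.mem → (∀ i < r, s'.reg i = s.reg i) →
      v.Fits W s' ∧ v.eval s' = x) :
    (rep r m v).Emits W r s (m.cost + 5 + M * (v.cost + 9)) (List.replicate M x) := by
  let I : ℕ → RamState → Prop := fun i s' => s'.mem = s.mem ∧
    s'.out = s.out ++ List.replicate i x ∧ (∀ i < r, s'.reg i = s.reg i) ∧ s'.reg r = M - i
  have h₁ : (assign r m).Runs W s (m.cost + 1) (I 0) := by
    refine Wp.runs (p := assign r m) ⟨hm, rfl, by simp, fun i hi => ?_, ?_⟩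
    · simp [Function.update_of_ne hi.ne]
    · simp [hM]
  refine (Runs.seq h₁ fun s₁ hs₁ => Runs.loop I M (v.cost + 5) ?_ ?_ hs₁).mono ?_ ?_
  · rintro i hi s' ⟨h1, h2, h3, h4⟩
    obtain ⟨hf, hx⟩ := hv s' h1 h3
    refine ⟨⟨Nat.zero_le _, ?_, hW⟩, ?_, ?_⟩
    · change s'.reg r ≤ W
      omega
    · simp [RamExpr.eval, h4, hi]
    · refine (Wp.runs (p := .seq (.emit v) (.assign r (.sub (.reg r) (.lit 1)))) (Q := I (i + 1))
        ⟨hf, ⟨by change s'.reg r ≤ W; omega, hW⟩, h1, ?_, fun j hj => ?_, ?_⟩).mono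
        (by simp [size, RamExpr.cost]) (fun _ h => h)
      · simp [h2, hx, List.replicate_succ']
      · simp [Function.update_of_ne hj.ne, h3 j hj]
      · simp [RamExpr.eval, h4, Nat.sub_sub]
  · rintro s' ⟨h1, h2, h3, h4⟩
    refine ⟨⟨Nat.zero_le _, ?_, hW⟩, ?_⟩
    · change s'.reg r ≤ W
      omega
    · simp [RamExpr.eval, h4]
  · simp only [RamExpr.cost]
    rw [show 1 + 1 + 1 + 1 + (v.cost + 5) = v.cost + 9 by ring]
    omega
  · rintro s' ⟨h1, h2, h3, -⟩
    exact ⟨h1, h2, h3⟩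

/-- Execute `p` for every record of six words, with register `r` as pointer. -/
def forEach (r : ℕ) (p : RamProg) : RamProg :=
  .seq (.assign r (.lit 0))
    (.loop (.lt (.reg r) (.mul (.lit 6) (.reg 2)))
      (.seq p (.assign r (.add (.reg r) (.lit 6)))))

/-- The body has to preserve the pointer, hence `r + 1` in `hp`; this permits nested traversals with
different pointers. -/
theorem emits_forEach {W r T : ℕ} {p : RamProg} {s : RamState} {ι : Type*} {L : List ι}
    {f : ι → List ℕ} (hr : 3 ≤ r) (hL : s.reg 2 = L.length) (hW : 6 * L.length + 6 ≤ W)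
    (hp : ∀ (i : ℕ) (hi : i < L.length) (s' : RamState), s'.mem = s.mem →
      (∀ i < r, s'.reg i = s.reg i) → s'.reg r = 6 * i → p.Emits W (r + 1) s' T (f L[i])) :
    (forEach r p).Emits W r s (L.length * (T + 10) + 8) (L.flatMap f) := by
  let I : ℕ → RamState → Prop := fun i s' => s'.mem = s.mem ∧
    s'.out = s.out ++ (L.take i).flatMap f ∧ (∀ i < r, s'.reg i = s.reg i) ∧ s'.reg r = 6 * i
  have h₁ : (assign r (.lit 0)).Runs W s 2 (I 0) := by
    refine Wp.runs (p := assign r (.lit 0)) ⟨Nat.zero_le _, rfl, by simp, fun i hi => ?_, ?_⟩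
    · simp [Function.update_of_ne hi.ne]
    · simp [RamExpr.eval]
  have hfit : ∀ i ≤ L.length, ∀ s', I i s' →
      RamExpr.Fits W s' (.lt (.reg r) (.mul (.lit 6) (.reg 2))) := by
    rintro i hi s' ⟨h1, h2, h3, h4⟩
    have h5 : s'.reg 2 = L.length := (h3 2 (by omega)).trans hL
    simp only [RamExpr.Fits, RamExpr.eval, h4, h5]
    omega
  refine (Runs.seq h₁ fun s₁ hs₁ => Runs.loop I L.length (T + 4) ?_ ?_ hs₁).mono ?_ ?_
  · rintro i hi s' hs'
    have hf := hfit i hi.le s' hs'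
    obtain ⟨h1, h2, h3, h4⟩ := hs'
    have h5 : s'.reg 2 = L.length := (h3 2 (by omega)).trans hL
    refine ⟨hf, ?_, Runs.seq (hp i hi s' h1 h3 h4) fun s₂ ⟨k1, k2, k3⟩ => ?_⟩
    · simp [RamExpr.eval, h4, h5]
      omega
    · have k4 : s₂.reg r = 6 * i := (k3 r (by omega)).trans h4
      refine Wp.runs (p := assign r (.add (.reg r) (.lit 6))) ⟨?_, k1.trans h1, ?_,
        fun j hj => ?_, ?_⟩
      · simp only [RamExpr.Fits, RamExpr.eval, k4]
        omega
      · change s₂.out = _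
        rw [k2, h2, List.take_succ_eq_append_getElem hi, List.flatMap_append, List.append_assoc,
          List.flatMap_singleton]
      · simp [Function.update_of_ne hj.ne, k3 j (by omega), h3 j hj]
      · simp [RamExpr.eval, k4]
        ring
  · rintro s' hs'
    refine ⟨hfit _ le_rfl s' hs', ?_⟩
    obtain ⟨h1, h2, h3, h4⟩ := hs'
    have h5 : s'.reg 2 = L.length := (h3 2 (by omega)).trans hL
    simp [RamExpr.eval, h4, h5]
  · simp only [RamExpr.cost]
    rw [show 1 + (1 + 1 + 1) + 1 + 1 + (T + 4) = T + 10 by ring]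
    omega
  · rintro s' ⟨h1, h2, h3, -⟩
    exact ⟨h1, by simpa using h2, h3⟩

end RamProg

/-- Every output takes time. -/
theorem Exec.out_length_le {W t : ℕ} {p : RamProg} {s s' : RamState} (h : Exec W p s t s') :
    s'.out.length ≤ s.out.length + t := by
  induction h with
  | emit e s h => simp
  | _ => first | omega | (dsimp only; omega)

/-! ## Join-irreducible partitions -/

namespace Ptn

variable {n : ℕ}

theorem pre_le (α : Ptn n) (j : ℕ) : α.pre j ≤ n :=
  (α.pre_mono (Nat.le_add_right j n)).trans_eq (α.pre_of_le (Nat.le_add_left n j))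

/-- Concavity of the partial sums as a linear upper bound; the next two lemmas are the matching
lower bounds. -/
theorem pre_add_le (α : Ptn n) (p u : ℕ) : α.pre (p + u) ≤ α.pre p + u * α.part p := by
  induction u with
  | zero => simp
  | succ u ih =>
    have h := α.anti (Nat.le_add_right p u)
    rw [← add_assoc, pre_succ, Nat.succ_mul]
    omega

theorem le_pre_add (α : Ptn n) (p u : ℕ) :
    α.pre p + u * α.part (p + u - 1) ≤ α.pre (p + u) := by
  induction u with
  | zero => simp
  | succ u ih =>
    have h := α.anti (show p + u - 1 ≤ p + u by omega)
    have h' := Nat.mul_le_mul_left u h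
    rw [← add_assoc, pre_succ, Nat.succ_mul, Nat.add_sub_cancel]
    omega

theorem le_pre_add' (α : Ptn n) (p u : ℕ) : α.pre p + u * α.part (p + u) ≤ α.pre (p + u) := by
  have h := Nat.mul_le_mul_left u (α.anti (show p + u - 1 ≤ p + u by omega))
  have h' := α.le_pre_add p u
  omega

theorem pre_eq_of_part_eq_zero (α : Ptn n) {j : ℕ} (h : α.part j = 0) : α.pre j = n := by
  have h₁ := α.pre_add_le j n
  rw [h, α.pre_of_le (Nat.le_add_left n j)] at h₁
  exact le_antisymm (α.pre_le j) (by simpa using h₁)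

theorem pre_add_of_part_eq (α : Ptn n) {p m h : ℕ} (hp : ∀ i, p ≤ i → i < p + m → α.part i = h) :
    ∀ u ≤ m, α.pre (p + u) = α.pre p + u * h := by
  intro u hu
  induction u with
  | zero => simp
  | succ u ih =>
    rw [← add_assoc, pre_succ, ih (by omega), hp (p + u) (by omega) (by omega), Nat.succ_mul,
      add_assoc]

/-- Partial sums that dominate a linear function at two places dominate it in between. -/
theorem le_pre_of_le_of_le (α : Ptn n) {p u v A h : ℕ} (h₁ : A ≤ α.pre p)
    (h₂ : A + (u + v) * h ≤ α.pre (p + u + v)) : A + u * h ≤ α.pre (p + u) := by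
  -- If the slope at `p + u` is at least `h`, the bound is carried forward from `p`; otherwise it is
  -- carried back from `p + u + v`.
  rcases le_total h (α.part (p + u)) with hc | hc
  · have h₃ := Nat.mul_le_mul_left u hc
    have h₄ := α.le_pre_add' p u
    omega
  · have h₃ := Nat.mul_le_mul_left v hc
    have h₄ := α.pre_add_le (p + u) v
    rw [Nat.add_mul] at h₂
    omega

/-- A partition with parts `h`, `h + 1` up to `q` and parts at most `1` from there on is the only
partition below it with the same partial sum at `q`. -/
theorem le_of_pre_eq {α β : Ptn n} {q h : ℕ} (hq : ∀ i < q, h ≤ α.part i)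
    (hh : ∀ i, α.part i ≤ h + 1) (ht : ∀ i, q ≤ i → α.part i ≤ 1) (he : β.pre q = α.pre q) :
    α ≤ β := by
  intro j
  change α.pre j ≤ β.pre j
  rcases le_total j q with hj | hj
  · obtain ⟨u, rfl⟩ := Nat.exists_eq_add_of_le hj
    -- Either the parts of `β` before `j` are all at least `h + 1`, the maximum allowed for `α`; or
    -- between `j` and `q` each part of `β` is at most `h`, each part of `α` at least `h`, and the
    -- partial sums agree at `q`.
    rcases le_or_gt (h + 1) (β.part j) with hc | hc
    · have h₁ := α.pre_add_le 0 j
      have h₂ := β.le_pre_add' 0 j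
      have h₃ := Nat.mul_le_mul_left j (hh 0)
      have h₄ := Nat.mul_le_mul_left j hc
      simp only [pre_zero, Nat.zero_add] at h₁ h₂
      omega
    · have h₁ := β.pre_add_le j u
      have h₃ := Nat.mul_le_mul_left u (Nat.lt_succ_iff.1 hc)
      rcases Nat.eq_zero_or_pos u with rfl | hu
      · exact he.ge
      have h₂ := α.le_pre_add j u
      have h₄ := Nat.mul_le_mul_left u (hq (j + u - 1) (by omega))
      omega
  · obtain ⟨u, rfl⟩ := Nat.exists_eq_add_of_le hj
    rcases Nat.eq_zero_or_pos (β.part (q + u)) with hc | hc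
    · rw [β.pre_eq_of_part_eq_zero hc]
      exact α.pre_le _
    · have h₁ := α.pre_add_le q u
      have h₂ := β.le_pre_add' q u
      have h₃ := Nat.mul_le_mul_left u (ht q le_rfl)
      have h₄ := Nat.mul_le_mul_left u hc
      omega

/-- A grain can be moved from column `s` to column `t + 1` (counting from one); the partial sums
decrease by one from `s` to `t`. -/
def CanMove (a : ℕ → ℕ) (s t : ℕ) : Prop :=
  1 ≤ s ∧ ((s = t ∧ a s + 2 ≤ a (s - 1)) ∨ (s < t ∧ a s < a (s - 1) ∧ a t < a (t - 1)))

/-- Only the parts at `s - 1` and `t` change, and the drops demanded by `CanMove` are what keeps the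
sequence antitone. -/
theorem CanMove.exists_lower {α : Ptn n} {s t : ℕ} (h : CanMove α.part s t) :
    ∃ β : Ptn n, ∀ j, β.pre j + (if s ≤ j ∧ j ≤ t then 1 else 0) = α.pre j := by
  obtain ⟨hs, h⟩ := h
  obtain ⟨s, rfl⟩ := Nat.exists_eq_add_of_le' hs
  obtain ⟨t, rfl⟩ : ∃ t', t = t' + 1 := ⟨t - 1, by omega⟩
  simp only [Nat.add_sub_cancel] at h
  have hst : s ≤ t := by omega
  have h2 : 2 ≤ α.part s := by
    rcases h with ⟨-, h⟩ | ⟨h₁, h₂, h₃⟩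
    · omega
    · have := α.anti (show s + 1 ≤ t by omega)
      omega
  have h1 : 1 ≤ α.part t := by
    rcases h with ⟨h₁, h⟩ | ⟨h₁, h₂, h₃⟩
    · obtain rfl : s = t := by omega
      omega
    · omega
  -- The parts up to position `t` are positive and the first is at least two. Hence `t + 1 < n`, and
  -- the partial sums from index `n` on are not touched.
  have htn : t + 2 ≤ α.pre (t + 1) := by
    obtain ⟨u, rfl⟩ := Nat.exists_eq_add_of_le hst
    have e₁ := α.le_pre_add' 0 s
    have e₂ := α.le_pre_add' s u
    have e₃ := Nat.mul_le_mul_left s h2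
    have e₄ := Nat.mul_le_mul_left u h1
    have e₅ := α.pre_succ (s + u)
    simp only [pre_zero, Nat.zero_add] at e₁
    rcases Nat.eq_zero_or_pos u with rfl | hu
    · simp only [Nat.add_zero] at *
      omega
    · rcases Nat.eq_zero_or_pos s with rfl | hs'
      · have e₆ := α.pre_succ 0
        have e₇ := α.le_pre_add' 1 (u - 1)
        rw [show 1 + (u - 1) = 0 + u by omega] at e₇
        have e₈ := Nat.mul_le_mul_left (u - 1) h1
        simp only [pre_zero, Nat.zero_add] at *
        omega
      · omega
  have hn := α.pre_le (t + 1)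
  have hpos : ∀ j, (if s + 1 ≤ j ∧ j ≤ t + 1 then 1 else 0) ≤ α.pre j := by
    intro j
    split_ifs with hj
    · have e₁ := α.pre_mono hj.1
      have e₂ := α.pre_succ s
      omega
    · exact Nat.zero_le _
  refine ⟨ofPre (fun j => α.pre j - if s + 1 ≤ j ∧ j ≤ t + 1 then 1 else 0) (by simp [pre_zero])
    (monotone_nat_of_le_succ fun j => ?_) (fun j => ?_) (fun j hj => ?_), fun j => ?_⟩
  · have e₁ := α.pre_succ j
    rcases Nat.lt_trichotomy j s with hj | rfl | hj
    · rw [if_neg (by omega), if_neg (by omega)]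
      omega
    · rw [if_neg (by omega), if_pos (by omega)]
      omega
    · split_ifs <;> omega
  · have e₁ := α.pre_succ j
    have e₂ := α.pre_succ (j + 1)
    have e₃ := α.anti (Nat.le_succ j)
    have e₄ := hpos j
    have e₅ := hpos (j + 1)
    have e₆ := hpos (j + 2)
    simp only [Nat.succ_eq_add_one, show j + 1 + 1 = j + 2 from rfl] at *
    by_cases c₁ : j = s
    · subst c₁
      split_ifs at * <;> omega
    · by_cases c₂ : j = t
      · subst c₂
        split_ifs at * <;> omega
      · split_ifs at * <;> omega
  · rw [α.pre_of_le hj, if_neg (by omega), Nat.sub_zero]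
  · rw [pre_ofPre]
    exact Nat.sub_add_cancel (hpos j)

theorem le_of_lower {α β : Ptn n} {s t : ℕ}
    (h : ∀ j, β.pre j + (if s ≤ j ∧ j ≤ t then 1 else 0) = α.pre j) : β ≤ α :=
  fun j => by
    change β.pre j ≤ α.pre j
    have := h j
    omega

theorem CanMove.le {a : ℕ → ℕ} {s t : ℕ} (h : CanMove a s t) : s ≤ t := by
  rcases h with ⟨_, h | h⟩ <;> omega

theorem ne_of_lower {α β : Ptn n} {s t : ℕ} (hst : s ≤ t)
    (h : ∀ j, β.pre j + (if s ≤ j ∧ j ≤ t then 1 else 0) = α.pre j) : β ≠ α := by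
  rintro rfl
  have := h s
  rw [if_pos ⟨le_rfl, hst⟩] at this
  omega

/-- If all partitions strictly below `α` are below the one that arises from a single move, then
`α` is join-irreducible. -/
theorem CanMove.supIrred {α : Ptn n} {s t : ℕ} (h : CanMove α.part s t)
    (hr : ∀ β ≤ α, ∀ q, s ≤ q → q ≤ t → β.pre q = α.pre q → α ≤ β) : SupIrred α := by
  obtain ⟨γ, hγ⟩ := h.exists_lower
  have hle := le_of_lower hγ
  have hne := ne_of_lower h.le hγ
  have key : ∀ β ≤ α, β ≠ α → β ≤ γ := by
    intro β hβ hβα j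
    change β.pre j ≤ γ.pre j
    have h₁ := hγ j
    have h₂ : β.pre j ≤ α.pre j := hβ j
    split_ifs at h₁ with hj
    · have h₃ : β.pre j ≠ α.pre j := fun e => hβα (le_antisymm hβ (hr β hβ j hj.1 hj.2 e))
      omega
    · omega
  refine ⟨fun hmin => hne (le_antisymm hle (hmin hle)), fun b c hbc => ?_⟩
  by_contra hcon
  push Not at hcon
  exact hne (le_antisymm hle (hbc ▸ sup_le (key b (hbc ▸ le_sup_left) hcon.1)
    (key c (hbc ▸ le_sup_right) hcon.2)))

/-- Two moves from a join-irreducible partition leave a common upper bound strictly below it. -/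
theorem exists_lt_of_supIrred {α : Ptn n} (hα : SupIrred α) {s t s' t' : ℕ}
    (h : CanMove α.part s t) (h' : CanMove α.part s' t') :
    ∃ γ : Ptn n, (∃ j, γ.pre j < α.pre j) ∧
      ∀ j, γ.pre j < α.pre j → (s ≤ j ∧ j ≤ t) ∧ (s' ≤ j ∧ j ≤ t') := by
  obtain ⟨β, hβ⟩ := h.exists_lower
  obtain ⟨β', hβ'⟩ := h'.exists_lower
  have hne : β ⊔ β' ≠ α := fun e => (hα.2 e).elim (ne_of_lower h.le hβ) (ne_of_lower h'.le hβ')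
  have hle : β ⊔ β' ≤ α := sup_le (le_of_lower hβ) (le_of_lower hβ')
  refine ⟨β ⊔ β', ?_, fun j hj => ⟨?_, ?_⟩⟩
  · by_contra hcon
    push Not at hcon
    exact hne (le_antisymm hle hcon)
  · by_contra hc
    have h₁ := hβ j
    rw [if_neg hc] at h₁
    have h₂ : β.pre j ≤ (β ⊔ β').pre j := (le_sup_left : β ≤ β ⊔ β') j
    omega
  · by_contra hc
    have h₁ := hβ' j
    rw [if_neg hc] at h₁
    have h₂ : β'.pre j ≤ (β ⊔ β').pre j := (le_sup_right : β' ≤ β ⊔ β') j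
    omega

/-- The join of the two results can differ from `α` only where the two intervals overlap. -/
theorem not_supIrred_of_disjoint {α : Ptn n} {s t s' t' : ℕ} (h : CanMove α.part s t)
    (h' : CanMove α.part s' t') (hd : t < s') : ¬ SupIrred α := fun hα => by
  obtain ⟨γ, ⟨j, hj⟩, hγ⟩ := exists_lt_of_supIrred hα h h'
  have := hγ j hj
  omega

/-- The intervals share only `t`, and lowering the partial sum at `t` alone breaks concavity unless
the parts drop there by at least two. -/
theorem not_supIrred_of_step {α : Ptn n} {s t u : ℕ} (h : CanMove α.part s t)
    (h' : CanMove α.part t u) (hd : α.part (t - 1) ≤ α.part t + 1) : ¬ SupIrred α := fun hα => by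
  obtain ⟨γ, ⟨j, hj⟩, hγ⟩ := exists_lt_of_supIrred hα h h'
  obtain rfl : j = t := by have := hγ j hj; omega
  have h1 : 1 ≤ j := h'.1
  obtain ⟨j, rfl⟩ := Nat.exists_eq_add_of_le' h1
  have h2 := fun hlt => hγ j hlt
  have h3 := fun hlt => hγ (j + 2) hlt
  have h4 := γ.pre_concave j
  have h5 := α.pre_succ j
  have h6 := α.pre_succ (j + 1)
  simp only [Nat.add_sub_cancel, show j + 1 + 1 = j + 2 from rfl] at *
  omega

/-- Otherwise all parts are at most one and `α` is the least element. -/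
theorem two_le_of_supIrred {α : Ptn n} (hα : SupIrred α) : 2 ≤ α.part 0 := by
  by_contra hc
  refine hα.1 fun β _ => le_of_pre_eq (q := 0) (h := 0) (by simp) (fun i => ?_) (fun i _ => ?_)
    (by simp [pre_zero])
  all_goals
    have := α.anti (Nat.zero_le i)
    omega

/-- The run that starts at position `p`. -/
theorem exists_run (α : Ptn n) {p : ℕ} (hp : α.part p ≠ 0) :
    ∃ m, 1 ≤ m ∧ (∀ i, p ≤ i → i < p + m → α.part i = α.part p) ∧ α.part (p + m) < α.part p := by
  classical
  have hex : ∃ m, α.part (p + m) < α.part p :=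
    ⟨n, by rw [α.zero (p + n) (Nat.le_add_left _ _)]; omega⟩
  refine ⟨Nat.find hex, ?_, fun i h₁ h₂ => ?_, Nat.find_spec hex⟩
  · rw [Nat.one_le_iff_ne_zero]
    intro h
    have := Nat.find_spec hex
    rw [h] at this
    exact lt_irrefl _ this
  · have h := Nat.find_min hex (m := i - p) (by omega)
    rw [show p + (i - p) = i by omega] at h
    exact le_antisymm (α.anti h₁) (not_lt.1 h)

end Ptn

/-! ### Run-length codes -/

/-- A run-length code: up to three values with their multiplicities. -/
@[ext]
structure RunCode where
  h₁ : ℕ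
  m₁ : ℕ
  h₂ : ℕ
  m₂ : ℕ
  h₃ : ℕ
  m₃ : ℕ

namespace RunCode

/-- The sequence described by a code. -/
def fn (c : RunCode) (i : ℕ) : ℕ :=
  if i < c.m₁ then c.h₁ else if i < c.m₁ + c.m₂ then c.h₂ else
    if i < c.m₁ + c.m₂ + c.m₃ then c.h₃ else 0

def toList (c : RunCode) : List ℕ := [c.h₁, c.m₁, c.h₂, c.m₂, c.h₃, c.m₃]

/-- The number described by a code. -/
def total (c : RunCode) : ℕ := c.m₁ * c.h₁ + c.m₂ * c.h₂ + c.m₃ * c.h₃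

/-- The codes of the join-irreducible partitions of `n`. -/
def IsJoin (n : ℕ) (c : RunCode) : Prop :=
  c.total = n ∧ 1 ≤ c.m₁ ∧
  ((2 ≤ c.h₁ ∧ c.h₂ = 0 ∧ c.m₂ = 0 ∧ c.h₃ = 0 ∧ c.m₃ = 0) ∨
   (3 ≤ c.h₁ ∧ c.h₂ = 1 ∧ 1 ≤ c.m₂ ∧ c.h₃ = 0 ∧ c.m₃ = 0) ∨
   (c.h₁ = c.h₂ + 1 ∧ 1 ≤ c.h₂ ∧ 1 ≤ c.m₂ ∧ c.h₃ = 0 ∧ c.m₃ = 0) ∨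
   (c.h₁ = c.h₂ + 1 ∧ 3 ≤ c.h₂ ∧ 1 ≤ c.m₂ ∧ c.h₃ = 1 ∧ 1 ≤ c.m₃))

theorem IsJoin.lt {n : ℕ} {c : RunCode} (h : c.IsJoin n) : c.h₂ < c.h₁ ∧ c.h₃ ≤ c.h₂ := by
  have := h.2.2
  omega

theorem IsJoin.anti {n : ℕ} {c : RunCode} (h : c.IsJoin n) : Antitone c.fn := by
  have := h.lt
  refine antitone_nat_of_succ_le fun i => ?_
  simp only [fn]
  split_ifs <;> omega

/-- Used with the identity for totals and with `min · b` for the partial sums of the conjugate. -/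
theorem sum_range_fn (c : RunCode) (g : ℕ → ℕ) (hg : g 0 = 0) {N : ℕ}
    (hN : c.m₁ + c.m₂ + c.m₃ ≤ N) :
    ∑ i ∈ Finset.range N, g (c.fn i) = c.m₁ * g c.h₁ + c.m₂ * g c.h₂ + c.m₃ * g c.h₃ := by
  obtain ⟨u, rfl⟩ := Nat.exists_eq_add_of_le hN
  rw [Finset.sum_range_add, Finset.sum_range_add, Finset.sum_range_add]
  have e₁ : ∀ i ∈ Finset.range c.m₁, g (c.fn i) = g c.h₁ := fun i hi => by
    rw [Finset.mem_range] at hi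
    rw [fn, if_pos hi]
  have e₂ : ∀ i ∈ Finset.range c.m₂, g (c.fn (c.m₁ + i)) = g c.h₂ := fun i hi => by
    rw [Finset.mem_range] at hi
    rw [fn, if_neg (by omega), if_pos (by omega)]
  have e₃ : ∀ i ∈ Finset.range c.m₃, g (c.fn (c.m₁ + c.m₂ + i)) = g c.h₃ := fun i hi => by
    rw [Finset.mem_range] at hi
    rw [fn, if_neg (by omega), if_neg (by omega), if_pos (by omega)]
  have e₄ : ∀ i ∈ Finset.range u, g (c.fn (c.m₁ + c.m₂ + c.m₃ + i)) = 0 := fun i hi => by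
    rw [fn, if_neg (by omega), if_neg (by omega), if_neg (by omega), hg]
  rw [Finset.sum_congr rfl e₁, Finset.sum_congr rfl e₂, Finset.sum_congr rfl e₃,
    Finset.sum_congr rfl e₄]
  simp

/-- The number of parts is at most the number described. -/
theorem IsJoin.length_le {n : ℕ} {c : RunCode} (h : c.IsJoin n) : c.m₁ + c.m₂ + c.m₃ ≤ n := by
  obtain ⟨h₁, h₂, h₃⟩ := h
  rw [← h₁, total]
  have key : ∀ m h : ℕ, (m = 0 ∨ 1 ≤ h) → m ≤ m * h := fun m h hm => by
    rcases hm with rfl | hm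
    · simp
    · exact Nat.le_mul_of_pos_right m hm
  have k₁ := key c.m₁ c.h₁ (by omega)
  have k₂ := key c.m₂ c.h₂ (by omega)
  have k₃ := key c.m₃ c.h₃ (by omega)
  omega

/-- The partition with a given code. -/
def toPtn {n : ℕ} (c : RunCode) (h : c.IsJoin n) : Ptn n where
  part := c.fn
  anti := h.anti
  zero i hi := by
    have := h.length_le
    rw [fn, if_neg (by omega), if_neg (by omega), if_neg (by omega)]
  sum_eq := (sum_range_fn c id rfl h.length_le).trans h.1

end RunCode

/-! ### Classification of the join-irreducible partitions by their codes -/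

namespace Ptn

variable {n : ℕ}

theorem total_eq {α : Ptn n} {c : RunCode} (h : α.part = c.fn) : c.total = n := by
  have h₁ := α.pre_of_le (Nat.le_add_right n (c.m₁ + c.m₂ + c.m₃))
  rw [pre, h] at h₁
  rw [← h₁, RunCode.total]
  exact (c.sum_range_fn id rfl (Nat.le_add_left _ _)).symm

/-- It suffices to find a move over `[s, t]` and a number `g` such that the parts before `t` are at
least `g`, all parts are at most `g + 1`, and those from `s` on are at most one; then `le_of_pre_eq`
applies at every `q` of the interval. -/
theorem supIrred_of_isJoin {α : Ptn n} {c : RunCode} (hc : c.IsJoin n) (h : α.part = c.fn) :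
    SupIrred α := by
  obtain ⟨h₁, m₁, h₂, m₂, h₃, m₃⟩ := c
  have hn := hc.2
  simp only at hn
  obtain ⟨hm₁, hn⟩ := hn
  have key : ∀ i, α.part i = if i < m₁ then h₁ else if i < m₁ + m₂ then h₂ else
    if i < m₁ + m₂ + m₃ then h₃ else 0 := fun i => by rw [h]; rfl
  have main : ∀ s t g, CanMove α.part s t → (∀ i < t, g ≤ α.part i) → (∀ i, α.part i ≤ g + 1) →
      (∀ i, s ≤ i → α.part i ≤ 1) → SupIrred α := fun s t g hm hg hg' hs =>
    hm.supIrred fun β _ q hsq hqt he => le_of_pre_eq (fun i hi => hg i (by omega)) hg'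
      (fun i hi => hs i (by omega)) he
  -- The grain falls off the cliff that ends the first run, or slides over all ones in `2…2 1…1`, or
  -- falls off the cliff that ends the second run.
  by_cases c₁ : m₂ = 0 ∨ 3 ≤ h₁ ∧ h₂ = 1
  · refine main m₁ m₁ h₁ ⟨hm₁, Or.inl ⟨rfl, ?_⟩⟩ ?_ ?_ ?_ <;> (try intro i) <;>
      simp only [key] <;> split_ifs <;> omega
  · by_cases c₂ : h₁ = 2
    · refine main m₁ (m₁ + m₂) 1 ⟨hm₁, Or.inr ⟨by omega, ?_, ?_⟩⟩ ?_ ?_ ?_ <;> (try intro i) <;>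
        simp only [key] <;> split_ifs <;> omega
    · refine main (m₁ + m₂) (m₁ + m₂) h₂ ⟨by omega, Or.inl ⟨rfl, ?_⟩⟩ ?_ ?_ ?_ <;>
        (try intro i) <;> simp only [key] <;> split_ifs <;> omega

/-- The runs are peeled off one by one; whatever leaves the four shapes offers two moves that
`not_supIrred_of_disjoint` or `not_supIrred_of_step` forbids. -/
theorem exists_isJoin_of_supIrred {α : Ptn n} (hα : SupIrred α) :
    ∃ c : RunCode, c.IsJoin n ∧ α.part = c.fn := by
  -- The total is automatic by `total_eq`, so only the shape is at stake.
  suffices H : ∃ c : RunCode, (c.total = n → c.IsJoin n) ∧ α.part = c.fn by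
    obtain ⟨c, h₁, h₂⟩ := H
    exact ⟨c, h₁ (total_eq h₂), h₂⟩
  have two := two_le_of_supIrred hα
  obtain ⟨m₁, hm₁, e₁, d₁⟩ := α.exists_run (p := 0) (by omega)
  simp only [Nat.zero_add] at e₁ d₁
  have z : ∀ {q}, α.part q = 0 → ∀ i, q ≤ i → α.part i = 0 := fun hq i hi => by
    have := α.anti hi
    omega
  have p₁ := e₁ (m₁ - 1) (Nat.zero_le _) (by omega)
  by_cases c₁ : α.part m₁ = 0
  · refine ⟨⟨α.part 0, m₁, 0, 0, 0, 0⟩, fun h => ⟨h, by simp [hm₁, two]⟩, funext fun i => ?_⟩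
    simp only [RunCode.fn]
    split_ifs with g₁
    · exact e₁ i (Nat.zero_le _) g₁
    all_goals first | omega | exact z c₁ i (by omega)
  obtain ⟨m₂, hm₂, e₂, d₂⟩ := α.exists_run c₁
  have p₂ := e₂ (m₁ + m₂ - 1) (by omega) (by omega)
  by_cases c₂ : α.part (m₁ + m₂) = 0
  · refine ⟨⟨α.part 0, m₁, α.part m₁, m₂, 0, 0⟩, fun h => ⟨h, hm₁, ?_⟩, funext fun i => ?_⟩
    -- Two cliffs would give two disjoint moves.
    · have hd : ¬ (α.part m₁ + 2 ≤ α.part 0 ∧ 2 ≤ α.part m₁) := fun hd =>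
        not_supIrred_of_disjoint (s := m₁) (t := m₁) (s' := m₁ + m₂) (t' := m₁ + m₂)
          ⟨hm₁, Or.inl ⟨rfl, by omega⟩⟩ ⟨by omega, Or.inl ⟨rfl, by omega⟩⟩ (by omega) hα
      simp only [and_true]
      omega
    · simp only [RunCode.fn]
      split_ifs with g₁ g₂
      · exact e₁ i (Nat.zero_le _) g₁
      · exact e₂ i (by omega) g₂
      all_goals first | omega | exact z c₂ i (by omega)
  obtain ⟨m₃, hm₃, e₃, d₃⟩ := α.exists_run c₂
  have p₃ := e₃ (m₁ + m₂ + m₃ - 1) (by omega) (by omega)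
  have mv₁₂ : CanMove α.part m₁ (m₁ + m₂) := ⟨by omega, Or.inr ⟨by omega, by omega, by omega⟩⟩
  have mv₂₃ : CanMove α.part (m₁ + m₂) (m₁ + m₂ + m₃) :=
    ⟨by omega, Or.inr ⟨by omega, by omega, by omega⟩⟩
  -- A fourth run could be crossed by a move disjoint from the one across the second run.
  have c₃ : α.part (m₁ + m₂ + m₃) = 0 := by
    by_contra c₃
    obtain ⟨m₄, hm₄, e₄, d₄⟩ := α.exists_run c₃
    have p₄ := e₄ (m₁ + m₂ + m₃ + m₄ - 1) (by omega) (by omega)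
    exact not_supIrred_of_disjoint (s' := m₁ + m₂ + m₃) (t' := m₁ + m₂ + m₃ + m₄) mv₁₂
      ⟨by omega, Or.inr ⟨by omega, by omega, by omega⟩⟩ (by omega) hα
  refine ⟨⟨α.part 0, m₁, α.part m₁, m₂, α.part (m₁ + m₂), m₃⟩, fun h => ⟨h, hm₁, ?_⟩,
    funext fun i => ?_⟩
  · have f₁ : ¬ (α.part m₁ + 2 ≤ α.part 0) := fun hd =>
      not_supIrred_of_disjoint (s := m₁) (t := m₁) ⟨hm₁, Or.inl ⟨rfl, by omega⟩⟩ mv₂₃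
        (by omega) hα
    have f₂ : ¬ (2 ≤ α.part (m₁ + m₂)) := fun hd =>
      not_supIrred_of_disjoint (s' := m₁ + m₂ + m₃) (t' := m₁ + m₂ + m₃) mv₁₂
        ⟨by omega, Or.inl ⟨rfl, by omega⟩⟩ (by omega) hα
    -- The moves across the second and the third run meet only at the end of the second, so the drop
    -- there is at least two.
    have f₃ : ¬ (α.part m₁ ≤ α.part (m₁ + m₂) + 1) := fun hd =>
      not_supIrred_of_step mv₁₂ mv₂₃ (by omega) hα
    simp only
    omega
  · simp only [RunCode.fn]
    split_ifs with g₁ g₂ g₃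
    · exact e₁ i (Nat.zero_le _) g₁
    · exact e₂ i (by omega) g₂
    · exact e₃ i (by omega) g₃
    · exact z c₃ i (by omega)

/-- The run-length code as a record. -/
def code (α : Ptn n) : RunCode where
  h₁ := α.part 0
  m₁ := α.mult (α.part 0)
  h₂ := α.part (α.mult (α.part 0))
  m₂ := α.mult (α.part (α.mult (α.part 0)))
  h₃ := α.part (α.mult (α.part 0) + α.mult (α.part (α.mult (α.part 0))))
  m₃ := α.mult (α.part (α.mult (α.part 0) + α.mult (α.part (α.mult (α.part 0)))))

theorem runs_eq (α : Ptn n) : α.runs = α.code.toList := rfl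

theorem mult_eq {α : Ptn n} {h p m : ℕ} (hh : 1 ≤ h) (hm : p + m ≤ n)
    (hi : ∀ i, α.part i = h ↔ p ≤ i ∧ i < p + m) : α.mult h = m := by
  rw [mult, if_neg (by omega), show (Finset.range n).filter (fun i => α.part i = h) =
    Finset.Ico p (p + m) by
      ext i
      simp only [Finset.mem_filter, Finset.mem_range, Finset.mem_Ico, hi]
      omega]
  simp

/-- The values of the runs strictly decrease and absent runs are coded by zeros, so a
join-irreducible partition has only one code of the four shapes. -/
theorem code_eq {α : Ptn n} {c : RunCode} (hc : c.IsJoin n) (h : α.part = c.fn) : α.code = c := by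
  have hl := hc.length_le
  obtain ⟨h₁, m₁, h₂, m₂, h₃, m₃⟩ := c
  have hn := hc.2
  simp only at hn hl
  have key : ∀ i, α.part i = if i < m₁ then h₁ else if i < m₁ + m₂ then h₂ else
    if i < m₁ + m₂ + m₃ then h₃ else 0 := fun i => by rw [h]; rfl
  have a₁ : α.part 0 = h₁ := by rw [key, if_pos (by omega)]
  have b₁ : α.mult h₁ = m₁ := mult_eq (p := 0) (by omega) (by omega) fun i => by
    rw [key]
    split_ifs <;> omega
  have a₂ : α.part m₁ = h₂ := by
    rw [key]
    split_ifs <;> omega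
  have b₂ : α.mult h₂ = m₂ := by
    by_cases hz : h₂ = 0
    · rw [mult, if_pos hz]
      omega
    · refine mult_eq (p := m₁) (by omega) (by omega) fun i => ?_
      rw [key]
      split_ifs <;> omega
  have a₃ : α.part (m₁ + m₂) = h₃ := by
    rw [key]
    split_ifs <;> omega
  have b₃ : α.mult h₃ = m₃ := by
    by_cases hz : h₃ = 0
    · rw [mult, if_pos hz]
      omega
    · refine mult_eq (p := m₁ + m₂) (by omega) (by omega) fun i => ?_
      rw [key]
      split_ifs <;> omega
  simp only [code, a₁, b₁, a₂, b₂, a₃, b₃]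

theorem mem_J_iff {α : Ptn n} : α ∈ J n ↔ ∃ c : RunCode, c.IsJoin n ∧ α.part = c.fn :=
  ⟨exists_isJoin_of_supIrred, fun ⟨_, hc, h⟩ => supIrred_of_isJoin hc h⟩

theorem code_spec {α : Ptn n} (h : α ∈ J n) : α.code.IsJoin n ∧ α.part = α.code.fn := by
  obtain ⟨c, hc, h⟩ := mem_J_iff.1 h
  rw [code_eq hc h]
  exact ⟨hc, h⟩

theorem code_injOn : Set.InjOn (code (n := n)) (J n) := fun α hα β hβ h => by
  have h₁ := (code_spec hα).2
  have h₂ := (code_spec hβ).2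
  exact Ptn.ext (by rw [h₁, h₂, h])

end Ptn

namespace RunCode

theorem toPtn_mem {n : ℕ} {c : RunCode} (h : c.IsJoin n) : c.toPtn h ∈ J n :=
  mem_J_iff.2 ⟨c, h, rfl⟩

theorem code_toPtn {n : ℕ} {c : RunCode} (h : c.IsJoin n) : (c.toPtn h).code = c :=
  code_eq h rfl

end RunCode

/-! ## Conjugation and meet-irreducible partitions -/

namespace Ptn

variable {n : ℕ}

theorem part_le (α : Ptn n) (i : ℕ) : α.part i ≤ n := by
  have h₁ := α.pre_succ i
  have h₂ := α.pre_le (i + 1)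
  omega

/-- The partial sums of the conjugate partition. -/
def conjPre (α : Ptn n) (b : ℕ) : ℕ := ∑ i ∈ Finset.range n, min (α.part i) b

/-- The conjugate partition. -/
def conj (α : Ptn n) : Ptn n :=
  ofPre α.conjPre (by simp [conjPre])
    (fun _ _ h => Finset.sum_le_sum fun _ _ => min_le_min_left _ h)
    (fun b => by
      simp only [conjPre]
      rw [Finset.mul_sum, ← Finset.sum_add_distrib]
      exact Finset.sum_le_sum fun i _ => by omega)
    (fun b hb => (Finset.sum_congr rfl fun i _ => min_eq_left ((α.part_le i).trans hb)).trans
      α.sum_eq)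

theorem pre_conj (α : Ptn n) (b : ℕ) : α.conj.pre b = ∑ i ∈ Finset.range n, min (α.part i) b :=
  pre_ofPre _ _ _ _ _ b

theorem part_conj (α : Ptn n) (b : ℕ) :
    α.conj.part b = ((Finset.range n).filter fun i => b < α.part i).card := by
  have h := α.conj.pre_succ b
  rw [pre_conj, pre_conj] at h
  have h' : ∑ i ∈ Finset.range n, min (α.part i) (b + 1) =
      ∑ i ∈ Finset.range n, min (α.part i) b +
        ∑ i ∈ Finset.range n, if b < α.part i then 1 else 0 := by
    rw [← Finset.sum_add_distrib]
    exact Finset.sum_congr rfl fun i _ => by split_ifs <;> omega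
  rw [Finset.card_filter]
  omega

/-- Both sides say that a certain cell lies in the Young diagram; this symmetry makes `conj` an
involution. -/
theorem lt_part_conj_iff (α : Ptn n) (i b : ℕ) : i < α.conj.part b ↔ b < α.part i := by
  rw [part_conj]
  constructor
  · intro h
    by_contra hc
    have hsub : (Finset.range n).filter (fun j => b < α.part j) ⊆ Finset.range i := fun j hj => by
      rw [Finset.mem_filter] at hj
      rw [Finset.mem_range]
      by_contra hji
      have := α.anti (not_lt.1 hji)
      omega
    have := Finset.card_le_card hsub
    rw [Finset.card_range] at this
    omega
  · intro h
    have hsub : Finset.range (i + 1) ⊆ (Finset.range n).filter (fun j => b < α.part j) :=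
      fun j hj => by
        rw [Finset.mem_range] at hj
        have hb := α.anti (Nat.lt_succ_iff.1 hj)
        rw [Finset.mem_filter, Finset.mem_range]
        refine ⟨?_, by omega⟩
        by_contra hjn
        have := α.zero j (not_lt.1 hjn)
        omega
    have := Finset.card_le_card hsub
    rw [Finset.card_range] at this
    omega

theorem conj_conj (α : Ptn n) : α.conj.conj = α := by
  ext i
  refine eq_of_forall_lt_iff fun b => ?_
  rw [lt_part_conj_iff, lt_part_conj_iff]

/-- Let `j` be the number of parts of `α` exceeding `b`. The sum of the parts of `α` truncated at
`b` equals `j * b + n - α.pre j`, while that for `β` is at most `j * b + n - β.pre j`. -/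
theorem conj_anti {α β : Ptn n} (h : α ≤ β) : β.conj ≤ α.conj := by
  intro b
  change β.conj.pre b ≤ α.conj.pre b
  rw [pre_conj, pre_conj]
  set j := α.conj.part b with hj
  have hjn : j ≤ n := α.conj.part_le b
  obtain ⟨u, hu⟩ := Nat.exists_eq_add_of_le hjn
  have hsum : ∀ f : ℕ → ℕ, ∑ i ∈ Finset.range n, f i =
      ∑ i ∈ Finset.range j, f i + ∑ i ∈ Finset.range u, f (j + i) := fun f => by
    conv_lhs => rw [hu]
    exact Finset.sum_range_add f j u
  have hα₁ : ∑ i ∈ Finset.range j, min (α.part i) b = j * b := by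
    rw [Finset.sum_congr rfl (g := fun _ => b) fun i hi => ?_]
    · simp
    · rw [Finset.mem_range, hj, lt_part_conj_iff] at hi
      omega
  have hα₂ : ∑ i ∈ Finset.range u, min (α.part (j + i)) b = ∑ i ∈ Finset.range u, α.part (j + i) :=
    Finset.sum_congr rfl fun i _ => by
      have : ¬ j + i < α.conj.part b := by omega
      rw [lt_part_conj_iff] at this
      omega
  have hβ₁ : ∑ i ∈ Finset.range j, min (β.part i) b ≤ j * b := by
    calc _ ≤ ∑ i ∈ Finset.range j, b := Finset.sum_le_sum fun i _ => min_le_right _ _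
      _ = j * b := by simp
  have hβ₂ : ∑ i ∈ Finset.range u, min (β.part (j + i)) b ≤
      ∑ i ∈ Finset.range u, β.part (j + i) := Finset.sum_le_sum fun i _ => min_le_left _ _
  have hα := hsum α.part
  have hβ := hsum β.part
  rw [α.sum_eq] at hα
  rw [β.sum_eq] at hβ
  have hpre : α.pre j ≤ β.pre j := h j
  simp only [pre] at hpre
  rw [hsum, hsum, hα₁, hα₂]
  omega

theorem conj_le_conj_iff {α β : Ptn n} : α.conj ≤ β.conj ↔ β ≤ α :=
  ⟨fun h => by simpa only [conj_conj] using conj_anti h, conj_anti⟩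

theorem conj_injective : Function.Injective (conj (n := n)) :=
  Function.LeftInverse.injective conj_conj

/-- Conjugation as an anti-automorphism. -/
def conjIso (n : ℕ) : Ptn n ≃o (Ptn n)ᵒᵈ where
  toFun α := OrderDual.toDual α.conj
  invFun α := (OrderDual.ofDual α).conj
  left_inv := conj_conj
  right_inv := conj_conj
  map_rel_iff' := conj_le_conj_iff

/-- An anti-automorphism exchanges joins and meets; so a list of the objects also yields the
attributes. -/
theorem conj_mem_M_iff {α : Ptn n} : α.conj ∈ M n ↔ α ∈ J n := by
  have hsup : ∀ β γ : Ptn n, (β ⊔ γ).conj = β.conj ⊓ γ.conj := fun β γ =>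
    (conjIso n).map_sup β γ
  constructor
  · rintro ⟨h₁, h₂⟩
    refine ⟨fun hmin => h₁ fun β hβ => ?_, fun β γ h => ?_⟩
    · have := hmin (show β.conj ≤ α by simpa only [conj_conj] using conj_anti hβ)
      simpa only [conj_conj] using conj_anti this
    · exact (h₂ (by rw [← hsup, h])).imp (fun h => conj_injective h) (fun h => conj_injective h)
  · rintro ⟨h₁, h₂⟩
    refine ⟨fun hmax => h₁ fun β hβ => ?_, fun β γ h => ?_⟩
    · exact conj_le_conj_iff.1 (hmax (conj_anti hβ))
    · have := h₂ (b := β.conj) (c := γ.conj) (conj_injective (by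
        rw [hsup, conj_conj, conj_conj, h]))
      exact this.imp (fun h => by rw [← h, conj_conj]) (fun h => by rw [← h, conj_conj])

theorem Lists.map_conj {L : List (Ptn n)} (h : Lists L (J n)) : Lists (L.map conj) (M n) := by
  refine ⟨h.1.map conj_injective, fun α => ?_⟩
  rw [← α.conj_conj, conj_mem_M_iff, List.mem_map_of_injective conj_injective, h.2]

theorem Lists.length_eq {L L' : List (Ptn n)} {A : Set (Ptn n)} (h : Lists L A)
    (h' : Lists L' A) : L.length = L'.length :=
  ((List.perm_ext_iff_of_nodup h.1 h'.1).2 fun α => (h.2 α).trans (h'.2 α).symm).length_eq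

theorem Lists.length_le {L L' : List (Ptn n)} {A B : Set (Ptn n)} (h : Lists L A)
    (h' : Lists L' B) (hAB : A ⊆ B) : L.length ≤ L'.length :=
  (h.1.subperm fun α hα => (h'.2 α).2 (hAB ((h.2 α).1 hα))).length_le

/-! ### Explicit descriptions by run-length codes -/

theorem pre_conj_of_code {α : Ptn n} {c : RunCode} (hc : c.IsJoin n) (h : α.part = c.fn) (b : ℕ) :
    α.conj.pre b = c.m₁ * min c.h₁ b + c.m₂ * min c.h₂ b + c.m₃ * min c.h₃ b := by
  rw [pre_conj, h]
  exact c.sum_range_fn (fun x => min x b) (Nat.zero_min b) hc.length_le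

/-- The code of the conjugate, listed by increasing values of the original. -/
theorem part_conj_of_code {α : Ptn n} {c : RunCode} (hc : c.IsJoin n) (h : α.part = c.fn)
    (b : ℕ) : α.conj.part b = if b < c.h₃ then c.m₁ + c.m₂ + c.m₃ else
      if b < c.h₂ then c.m₁ + c.m₂ else if b < c.h₁ then c.m₁ else 0 := by
  have hl := hc.lt
  refine eq_of_forall_lt_iff fun i => ?_
  rw [lt_part_conj_iff, h, RunCode.fn]
  split_ifs <;> omega

/-- The partial sums of `α` are linear on each run and those of `β` are concave, so the ends of the
runs decide. This is why a cell of the cross table takes constant time. -/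
theorem le_iff_of_code {α β : Ptn n} {c : RunCode} (hc : c.IsJoin n) (h : α.part = c.fn) :
    α ≤ β ↔ c.m₁ * c.h₁ ≤ β.pre c.m₁ ∧
      c.m₁ * c.h₁ + c.m₂ * c.h₂ ≤ β.pre (c.m₁ + c.m₂) ∧
      c.total ≤ β.pre (c.m₁ + c.m₂ + c.m₃) := by
  have e₁ : ∀ u ≤ c.m₁, α.pre u = u * c.h₁ := fun u hu => by
    have := α.pre_add_of_part_eq (p := 0) (m := c.m₁) (h := c.h₁) (fun i _ hi => by
      rw [h, RunCode.fn, if_pos (by omega)]) u hu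
    simpa [pre_zero] using this
  have e₂ : ∀ u ≤ c.m₂, α.pre (c.m₁ + u) = c.m₁ * c.h₁ + u * c.h₂ := fun u hu => by
    rw [α.pre_add_of_part_eq (p := c.m₁) (m := c.m₂) (h := c.h₂) (fun i _ hi => by
      rw [h, RunCode.fn, if_neg (by omega), if_pos (by omega)]) u hu, e₁ _ le_rfl]
  have e₃ : ∀ u ≤ c.m₃, α.pre (c.m₁ + c.m₂ + u) = c.m₁ * c.h₁ + c.m₂ * c.h₂ + u * c.h₃ :=
    fun u hu => by
      rw [α.pre_add_of_part_eq (p := c.m₁ + c.m₂) (m := c.m₃) (h := c.h₃) (fun i _ hi => by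
        rw [h, RunCode.fn, if_neg (by omega), if_neg (by omega), if_pos (by omega)]) u hu,
        e₂ _ le_rfl]
  constructor
  · intro hle
    have hle' : ∀ j, α.pre j ≤ β.pre j := hle
    refine ⟨?_, ?_, ?_⟩
    · rw [← e₁ _ le_rfl]
      exact hle' _
    · rw [← e₂ _ le_rfl]
      exact hle' _
    · rw [RunCode.total, ← e₃ _ le_rfl]
      exact hle' _
  · rintro ⟨h₁, h₂, h₃⟩ j
    change α.pre j ≤ β.pre j
    rw [RunCode.total] at h₃
    rcases le_total j c.m₁ with hj | hj
    · obtain ⟨v, hv⟩ := Nat.exists_eq_add_of_le hj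
      have := β.le_pre_of_le_of_le (p := 0) (u := j) (v := v) (A := 0) (h := c.h₁)
        (Nat.zero_le _) (by simpa [← hv] using h₁)
      rw [e₁ j hj]
      simpa using this
    obtain ⟨u, rfl⟩ := Nat.exists_eq_add_of_le hj
    rcases le_total u c.m₂ with hu | hu
    · obtain ⟨v, hv⟩ := Nat.exists_eq_add_of_le hu
      rw [e₂ u hu]
      exact β.le_pre_of_le_of_le (v := v) h₁ (by rwa [add_assoc c.m₁, ← hv])
    obtain ⟨u, rfl⟩ := Nat.exists_eq_add_of_le hu
    rw [← add_assoc]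
    rcases le_total u c.m₃ with hu' | hu'
    · obtain ⟨v, hv⟩ := Nat.exists_eq_add_of_le hu'
      rw [e₃ u hu']
      exact β.le_pre_of_le_of_le (v := v) h₂ (by rwa [add_assoc (c.m₁ + c.m₂), ← hv])
    · have h₄ := β.pre_mono (show c.m₁ + c.m₂ + c.m₃ ≤ c.m₁ + c.m₂ + u by omega)
      have h₅ : c.total = n := hc.1
      have h₆ := α.pre_le (c.m₁ + c.m₂ + u)
      rw [RunCode.total] at h₅
      omega

theorem tuple_of_code {α : Ptn n} {c : RunCode} (hc : c.IsJoin n) (h : α.part = c.fn) :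
    α.tuple = List.replicate c.m₁ c.h₁ ++ (List.replicate c.m₂ c.h₂ ++
      (List.replicate c.m₃ c.h₃ ++ List.replicate (n - (c.m₁ + c.m₂ + c.m₃)) 0)) := by
  have hl := hc.length_le
  refine List.ext_getElem (by simp [tuple]; omega) fun i h₁ h₂ => ?_
  simp only [tuple, List.getElem_map, List.getElem_range, List.getElem_append,
    List.getElem_replicate, List.length_replicate, h, RunCode.fn]
  split_ifs <;> first | rfl | omega

theorem tuple_conj_of_code {α : Ptn n} {c : RunCode} (hc : c.IsJoin n) (h : α.part = c.fn) :
    α.conj.tuple = List.replicate c.h₃ (c.m₁ + c.m₂ + c.m₃) ++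
      (List.replicate (c.h₂ - c.h₃) (c.m₁ + c.m₂) ++
      (List.replicate (c.h₁ - c.h₂) c.m₁ ++ List.replicate (n - c.h₁) 0)) := by
  have hl := hc.lt
  have hn : c.h₁ ≤ n := by
    have := α.part_le 0
    rwa [h, RunCode.fn, if_pos (by have := hc.2.1; omega)] at this
  refine List.ext_getElem (by simp [tuple]; omega) fun i h₁ h₂ => ?_
  simp only [tuple, List.getElem_map, List.getElem_range, List.getElem_append,
    List.getElem_replicate, List.length_replicate, part_conj_of_code hc h]
  split_ifs <;> first | rfl | omega

end Ptn

/-! ## The recursion on run-length codes -/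

namespace RunCode

/-- The code of the partition that arises from the admissible grain addition. -/
def child (c : RunCode) : RunCode :=
  -- The first case is `Cl` or `NP`, with the grain on column one; the other is `Ss`, `NS` or `PP`,
  -- with the grain on the first column after the first run.
  if c.h₂ + 1 < c.h₁ then
    if c.m₁ < 2 then ⟨c.h₁ + 1, 1, c.h₂, c.m₂, c.h₃, c.m₃⟩
    -- A drop of at least two after the first run excludes a third run, so three slots suffice.
    else ⟨c.h₁ + 1, 1, c.h₁, c.m₁ - 1, c.h₂, c.m₂⟩
  else if c.m₂ < 2 then ⟨c.h₁, c.m₁ + 1, c.h₃, c.m₃, 0, 0⟩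
  else ⟨c.h₁, c.m₁ + 1, c.h₂, c.m₂ - 1, c.h₃, c.m₃⟩

/-- The code of `(2, 1, …, 1)`. -/
def two (k : ℕ) : RunCode := ⟨2, 1, 1, k - 2, 0, 0⟩

/-- The code of `(3, …, 3, 1, …, 1)` with `m` threes. -/
def threes (k m : ℕ) : RunCode := ⟨3, m, 1, k - 3 * m, 0, 0⟩

theorem isJoin_mk {n h₁ m₁ h₂ m₂ h₃ m₃ : ℕ} : IsJoin n ⟨h₁, m₁, h₂, m₂, h₃, m₃⟩ ↔
    m₁ * h₁ + m₂ * h₂ + m₃ * h₃ = n ∧ 1 ≤ m₁ ∧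
    ((2 ≤ h₁ ∧ h₂ = 0 ∧ m₂ = 0 ∧ h₃ = 0 ∧ m₃ = 0) ∨
     (3 ≤ h₁ ∧ h₂ = 1 ∧ 1 ≤ m₂ ∧ h₃ = 0 ∧ m₃ = 0) ∨
     (h₁ = h₂ + 1 ∧ 1 ≤ h₂ ∧ 1 ≤ m₂ ∧ h₃ = 0 ∧ m₃ = 0) ∨
     (h₁ = h₂ + 1 ∧ 3 ≤ h₂ ∧ 1 ≤ m₂ ∧ h₃ = 1 ∧ 1 ≤ m₃)) := Iff.rfl

theorem child_mk (h₁ m₁ h₂ m₂ h₃ m₃ : ℕ) : child ⟨h₁, m₁, h₂, m₂, h₃, m₃⟩ =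
    if h₂ + 1 < h₁ then
      if m₁ < 2 then ⟨h₁ + 1, 1, h₂, m₂, h₃, m₃⟩ else ⟨h₁ + 1, 1, h₁, m₁ - 1, h₂, m₂⟩
    else if m₂ < 2 then ⟨h₁, m₁ + 1, h₃, m₃, 0, 0⟩ else ⟨h₁, m₁ + 1, h₂, m₂ - 1, h₃, m₃⟩ := rfl

theorem fn_mk (h₁ m₁ h₂ m₂ h₃ m₃ i : ℕ) : fn ⟨h₁, m₁, h₂, m₂, h₃, m₃⟩ i =
    if i < m₁ then h₁ else if i < m₁ + m₂ then h₂ else if i < m₁ + m₂ + m₃ then h₃ else 0 := rfl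

theorem child_isJoin {k : ℕ} {c : RunCode} (h : c.IsJoin k) : c.child.IsJoin (k + 1) := by
  obtain ⟨h₁, m₁, h₂, m₂, h₃, m₃⟩ := c
  obtain ⟨ht, hm, hc⟩ := isJoin_mk.1 h
  obtain ⟨m₁, rfl⟩ := Nat.exists_eq_add_of_le' hm
  rw [child_mk]
  split_ifs with c₁ c₂ c₃
  · obtain rfl : m₁ = 0 := by omega
    exact isJoin_mk.2 ⟨by omega, by omega, by omega⟩
  · obtain ⟨m₁, rfl⟩ := Nat.exists_eq_add_of_le' (show 1 ≤ m₁ by omega)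
    have : m₃ * h₃ = 0 := by
      rw [Nat.mul_eq_zero]
      omega
    refine isJoin_mk.2 ⟨?_, by omega, by omega⟩
    rw [Nat.add_sub_cancel]
    linarith
  · obtain rfl : h₁ = h₂ + 1 := by omega
    obtain rfl : m₂ = 1 := by omega
    exact isJoin_mk.2 ⟨by linarith, by omega, by omega⟩
  · obtain ⟨m₂, rfl⟩ := Nat.exists_eq_add_of_le' (show 1 ≤ m₂ by omega)
    obtain rfl : h₁ = h₂ + 1 := by omega
    refine isJoin_mk.2 ⟨?_, by omega, by omega⟩
    rw [Nat.add_sub_cancel]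
    linarith

theorem two_isJoin {k : ℕ} (h : 3 ≤ k) : (two k).IsJoin k :=
  isJoin_mk.2 ⟨by omega, by omega, by omega⟩

theorem threes_isJoin {k m : ℕ} (h : 1 ≤ m) (hm : 3 * m < k) : (threes k m).IsJoin k :=
  isJoin_mk.2 ⟨by omega, by omega, by omega⟩

/-- The branch can be read off from the child: `m₁ = 1` exactly if the grain went on column one, and
a first drop of one singles out the second and fourth branches. -/
theorem child_injOn {k : ℕ} : Set.InjOn child {c | c.IsJoin k} := by
  rintro ⟨h₁, m₁, h₂, m₂, h₃, m₃⟩ ⟨-, hm, hc⟩ ⟨h₁', m₁', h₂', m₂', h₃', m₃'⟩ ⟨-, hm', hc'⟩ h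
  simp only [child] at h hm hc hm' hc'
  split_ifs at h <;> simp only [mk.injEq, true_and, and_true] at h ⊢ <;> omega

/-- A child with `m₁ = 1` had its first part raised to at least three. -/
theorem child_ne_two {k k' : ℕ} {c : RunCode} (h : c.IsJoin k) : c.child ≠ two k' := by
  obtain ⟨h₁, m₁, h₂, m₂, h₃, m₃⟩ := c
  obtain ⟨-, hm, hc⟩ := h
  simp only [child, two] at *
  split_ifs <;> simp only [ne_eq, mk.injEq, true_and, and_true] <;> omega

/-- Without one grain of the last three there remains `(3,…,3,2,1,…,1)`, which is not
join-irreducible, or `(2,1,…,1)`, whose child is a different one. -/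
theorem child_ne_threes {k k' m : ℕ} {c : RunCode} (h : c.IsJoin k) (hm : 3 * m < k') :
    c.child ≠ threes k' m := by
  obtain ⟨h₁, m₁, h₂, m₂, h₃, m₃⟩ := c
  obtain ⟨-, hm, hc⟩ := h
  simp only [child, threes] at *
  split_ifs <;> simp only [ne_eq, mk.injEq, and_true] <;> omega

/-- Every code that is not exceptional has a predecessor. -/
theorem exists_child {k : ℕ} (hk : 2 ≤ k) {c : RunCode} (h : c.IsJoin (k + 1)) :
    (∃ c' : RunCode, c'.IsJoin k ∧ c'.child = c) ∨ c = two (k + 1) ∨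
      ∃ m, 1 ≤ m ∧ 3 * m < k + 1 ∧ c = threes (k + 1) m := by
  obtain ⟨h₁, m₁, h₂, m₂, h₃, m₃⟩ := c
  obtain ⟨ht, hm, hc⟩ := isJoin_mk.1 h
  obtain ⟨m₁, rfl⟩ := Nat.exists_eq_add_of_le' hm
  obtain ⟨h₁, rfl⟩ := Nat.exists_eq_add_of_le' (show 1 ≤ h₁ by omega)
  -- In every case below the predecessor arises by taking one grain off the last column of the first
  -- run.
  have key : ∀ c' : RunCode, c'.total = k → (c'.total = k → c'.IsJoin k ∧ c'.child =
      ⟨h₁ + 1, m₁ + 1, h₂, m₂, h₃, m₃⟩) → ∃ c' : RunCode, c'.IsJoin k ∧ c'.child =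
      ⟨h₁ + 1, m₁ + 1, h₂, m₂, h₃, m₃⟩ := fun c' h₁ h₂ => ⟨c', h₂ h₁⟩
  rcases hc with ⟨a₁, rfl, rfl, rfl, rfl⟩ | ⟨a₁, rfl, a₂, rfl, rfl⟩ | ⟨a₁, a₂, a₃, rfl, rfl⟩ |
    ⟨a₁, a₂, a₃, rfl, a₄⟩
  · left
    rcases Nat.eq_zero_or_pos m₁ with rfl | hp
    · refine key ⟨h₁, 1, 0, 0, 0, 0⟩ (by simp only [total]; omega) fun e => ⟨isJoin_mk.2 ⟨e, by omega, by omega⟩, ?_⟩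
      rw [child_mk]
      split_ifs <;> simp only [mk.injEq, true_and, and_true] <;> omega
    · refine key ⟨h₁ + 1, m₁, h₁, 1, 0, 0⟩ (by simp only [total]; linarith)
        fun e => ⟨isJoin_mk.2 ⟨e, by omega, by omega⟩, ?_⟩
      rw [child_mk]
      split_ifs <;> simp only [mk.injEq, true_and, and_true] <;> omega
  · by_cases a₃ : h₁ = 2
    · subst a₃
      refine Or.inr (Or.inr ⟨m₁ + 1, by omega, by omega, ?_⟩)
      simp only [threes, mk.injEq, true_and, and_true]
      omega
    left
    rcases Nat.eq_zero_or_pos m₁ with rfl | hp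
    · refine key ⟨h₁, 1, 1, m₂, 0, 0⟩ (by simp only [total]; linarith) fun e => ⟨isJoin_mk.2 ⟨e, by omega, by omega⟩, ?_⟩
      rw [child_mk]
      split_ifs <;> simp only [mk.injEq, true_and, and_true] <;> omega
    · refine key ⟨h₁ + 1, m₁, h₁, 1, 1, m₂⟩ (by simp only [total]; linarith)
        fun e => ⟨isJoin_mk.2 ⟨e, by omega, by omega⟩, ?_⟩
      rw [child_mk]
      split_ifs <;> simp only [mk.injEq, true_and] <;> omega
  · obtain rfl : h₁ = h₂ := by omega
    rcases Nat.eq_zero_or_pos m₁ with rfl | hp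
    · by_cases a₄ : h₁ = 1
      · subst a₄
        refine Or.inr (Or.inl ?_)
        simp only [two, mk.injEq, true_and, and_true]
        omega
      · left
        refine key ⟨h₁, m₂ + 1, 0, 0, 0, 0⟩ (by simp only [total]; linarith)
          fun e => ⟨isJoin_mk.2 ⟨e, by omega, by omega⟩, ?_⟩
        rw [child_mk]
        split_ifs <;> simp only [mk.injEq, true_and, and_true] <;> omega
    · left
      refine key ⟨h₁ + 1, m₁, h₁, m₂ + 1, 0, 0⟩ (by simp only [total]; linarith)
        fun e => ⟨isJoin_mk.2 ⟨e, by omega, by omega⟩, ?_⟩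
      rw [child_mk]
      split_ifs <;> simp only [mk.injEq, true_and, and_true] <;> omega
  · left
    obtain rfl : h₁ = h₂ := by omega
    rcases Nat.eq_zero_or_pos m₁ with rfl | hp
    · refine key ⟨h₁, m₂ + 1, 1, m₃, 0, 0⟩ (by simp only [total]; linarith)
        fun e => ⟨isJoin_mk.2 ⟨e, by omega, by omega⟩, ?_⟩
      rw [child_mk]
      split_ifs <;> simp only [mk.injEq, true_and, and_true] <;> omega
    · refine key ⟨h₁ + 1, m₁, h₁, m₂ + 1, 1, m₃⟩ (by simp only [total]; linarith)
        fun e => ⟨isJoin_mk.2 ⟨e, by omega, by omega⟩, ?_⟩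
      rw [child_mk]
      split_ifs <;> simp only [mk.injEq, true_and, and_true] <;> omega

/-- One step of the recursion on lists of codes. -/
def stepList (k : ℕ) (C : List RunCode) : List RunCode :=
  -- The `m ≥ 1` with `3 * m < k + 1` are `1, …, k / 3`.
  C.map child ++ two (k + 1) :: (List.range (k / 3)).map fun i => threes (k + 1) (i + 1)

theorem mem_stepList {k : ℕ} {C : List RunCode} {c : RunCode} : c ∈ stepList k C ↔
    (∃ c' ∈ C, c'.child = c) ∨ c = two (k + 1) ∨
      ∃ m, 1 ≤ m ∧ 3 * m < k + 1 ∧ c = threes (k + 1) m := by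
  simp only [stepList, List.mem_append, List.mem_map, List.mem_cons, List.mem_range]
  refine or_congr Iff.rfl (or_congr Iff.rfl ⟨?_, ?_⟩)
  · rintro ⟨i, hi, rfl⟩
    exact ⟨i + 1, by omega, by omega, rfl⟩
  · rintro ⟨m, h₁, h₂, rfl⟩
    exact ⟨m - 1, by omega, by rw [Nat.sub_add_cancel h₁]⟩

theorem isJoin_of_mem_stepList {k : ℕ} (hk : 2 ≤ k) {C : List RunCode}
    (hC : ∀ c ∈ C, c.IsJoin k) {c : RunCode} (hc : c ∈ stepList k C) : c.IsJoin (k + 1) := by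
  rcases mem_stepList.1 hc with ⟨c', h, rfl⟩ | rfl | ⟨m, h₁, h₂, rfl⟩
  · exact child_isJoin (hC c' h)
  · exact two_isJoin (by omega)
  · exact threes_isJoin h₁ h₂

theorem nodup_stepList {k : ℕ} {C : List RunCode} (hC : ∀ c ∈ C, c.IsJoin k) (h : C.Nodup) :
    (stepList k C).Nodup := by
  rw [stepList, List.nodup_append, List.nodup_cons]
  refine ⟨h.map_on fun c hc c' hc' e => child_injOn (hC c hc) (hC c' hc') e, ⟨?_, ?_⟩, ?_⟩
  · simp [two, threes]
  · exact List.nodup_range.map fun i j hij => by simpa [threes] using (mk.inj hij).2.1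
  · intro c hc c' hc'
    rw [List.mem_map] at hc
    obtain ⟨c, hcC, rfl⟩ := hc
    simp only [List.mem_cons, List.mem_map, List.mem_range] at hc'
    rcases hc' with rfl | ⟨i, hi, rfl⟩
    · exact child_ne_two (hC c hcC)
    · exact child_ne_threes (hC c hcC) (by omega)

theorem length_stepList (k : ℕ) (C : List RunCode) :
    (stepList k C).length = C.length + (1 + k / 3) := by
  simp [stepList]
  omega

end RunCode

/-! ### The recursion on sets of partitions in terms of codes -/

namespace Ptn

open RunCode

variable {k : ℕ}

/-- A plateau at the first column is the whole first run; so `Cl` (for `m₁ = 1`) and `NP` (for `m₁ ≥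
2`) both ask for a drop of at least two after it. -/
theorem Cl_or_NP_iff {α : Ptn k} {c : RunCode} (hc : c.IsJoin k)
    (h : α.part = c.fn) : Cl α.part ∨ NP α.part ↔ c.h₂ + 1 < c.h₁ := by
  have hn := hc.2
  have key : ∀ i, α.part i = c.fn i := fun i => by rw [h]
  simp only [fn] at key
  constructor
  · rintro (h | ⟨l, h₁, h₂, h₃⟩)
    · rw [Cl, key, key] at h
      split_ifs at h <;> omega
    · have h₄ : c.m₁ = l + 1 := by
        have h₅ : ∀ i ≤ l, α.part i = c.h₁ := fun i hi => by
          induction i with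
          | zero => rw [key, if_pos (by omega)]
          | succ i ih => rw [← h₂ i (by omega), ih (by omega)]
        have h₆ := h₅ l le_rfl
        have h₇ := key l
        have h₈ := key (l + 1)
        split_ifs at h₇ h₈ <;> omega
      rw [key, key] at h₃
      split_ifs at h₃ <;> omega
  · intro hh
    rcases Nat.lt_or_ge c.m₁ 2 with hm | hm
    · left
      rw [Cl, key, key]
      split_ifs <;> omega
    · right
      refine ⟨c.m₁ - 1, by omega, fun i hi => ?_, ?_⟩
      · rw [key, key, if_pos (by omega), if_pos (by omega)]
      · rw [key, key]
        split_ifs <;> omega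

theorem PP_iff {α : Ptn k} {c : RunCode} (hc : c.IsJoin k)
    (h : α.part = c.fn) {l : ℕ} : PP l α.part ↔ c.h₁ = c.h₂ + 1 ∧ c.m₁ = l + 1 ∧ 1 ≤ l := by
  have hn := hc.2
  have key : ∀ i, α.part i = c.fn i := fun i => by rw [h]
  simp only [fn] at key
  constructor
  · rintro ⟨h₁, h₂, h₃⟩
    have h₄ : c.m₁ = l + 1 := by
      have h₅ : ∀ i ≤ l, α.part i = c.h₁ := fun i hi => by
        induction i with
        | zero => rw [key, if_pos (by omega)]
        | succ i ih => rw [← h₂ i (by omega), ih (by omega)]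
      have h₆ := h₅ l le_rfl
      have h₇ := key l
      have h₈ := key (l + 1)
      split_ifs at h₇ h₈ <;> omega
    rw [key, key] at h₃
    split_ifs at h₃ <;> omega
  · rintro ⟨h₁, h₂, h₃⟩
    refine ⟨h₃, fun i hi => ?_, ?_⟩
    · rw [key, key, if_pos (by omega), if_pos (by omega)]
    · rw [key, key]
      split_ifs <;> omega

/-- Once the first part exceeds the second by one, removing its grain creates a plateau of length
`m₂`; `Ss` and `NS` differ only in the drop behind it. -/
theorem Ss_or_NS_iff {α : Ptn k} {c : RunCode} (hc : c.IsJoin k)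
    (h : α.part = c.fn) : Ss α.part ∨ NS α.part ↔ c.h₁ = c.h₂ + 1 ∧ c.m₁ = 1 := by
  have hn := hc.2
  have key : ∀ i, α.part i = c.fn i := fun i => by rw [h]
  simp only [fn] at key
  have drop : ∀ i, dropGrain α.part i = if i = 0 then α.part 0 - 1 else α.part i := fun i => by
    rw [dropGrain, Function.update_apply]
  constructor
  · intro hor
    have h₁ : Antitone (dropGrain α.part) ∧ dropGrain α.part 0 = dropGrain α.part 1 := by
      rcases hor with ⟨_, h₂, l, h₃, h₄, _⟩ | ⟨_, h₂, l, h₃, h₄, _⟩ <;>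
        exact ⟨h₂, h₄ 0 (by omega)⟩
    have h₂ := h₁.2
    rw [drop, drop, if_pos rfl, if_neg (by omega), key, key] at h₂
    split_ifs at h₂ <;> omega
  · rintro ⟨h₁, h₂⟩
    have hm₂ : 1 ≤ c.m₂ := by omega
    have hfst : 1 ≤ α.part 0 := by
      rw [key]
      split_ifs <;> omega
    have hanti : Antitone (dropGrain α.part) := antitone_nat_of_succ_le fun i => by
      rw [drop, drop, key, key, key]
      split_ifs <;> first | omega | contradiction
    have hplat : ∀ i < c.m₂, dropGrain α.part i = dropGrain α.part (i + 1) := fun i hi => by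
      rw [drop, drop, key, key, key]
      split_ifs <;> omega
    have e₁ : dropGrain α.part c.m₂ = c.h₂ := by
      rw [drop, key, key]
      split_ifs <;> omega
    have e₂ : dropGrain α.part (c.m₂ + 1) = c.h₃ := by
      rw [drop, key, key]
      split_ifs <;> first | omega | contradiction
    rcases Nat.lt_or_ge (c.h₃ + 1) c.h₂ with hlt | hge
    · exact Or.inr ⟨hfst, hanti, c.m₂, hm₂, hplat, by omega⟩
    · exact Or.inl ⟨hfst, hanti, c.m₂, hm₂, hplat, by omega⟩

theorem addGrain_zero_of_code {c : RunCode} (hc : c.IsJoin k) (h : c.h₂ + 1 < c.h₁) :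
    addGrain 0 c.fn = c.child.fn := by
  have hn := hc.2
  funext i
  rw [addGrain, Function.update_apply, child, if_pos h]
  split_ifs with h₁ h₂ h₂ <;> simp only [fn_mk] <;> simp only [fn] <;> split_ifs <;> omega

/-- Position `m₁` is column 2 for `Ss` and `NS`, where `m₁ = 1`, and column `l + 2` for `PP l`,
where `m₁ = l + 1`. -/
theorem addGrain_of_code {c : RunCode} (hc : c.IsJoin k) (h : c.h₁ = c.h₂ + 1) :
    addGrain c.m₁ c.fn = c.child.fn := by
  have hn := hc.2
  funext i
  rw [addGrain, Function.update_apply, child, if_neg (show ¬ (c.h₂ + 1 < c.h₁) by omega)]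
  split_ifs with h₁ h₂ h₂ <;> simp only [fn_mk] <;> simp only [fn] <;> split_ifs <;> omega

theorem mem_E₁_iff (hk : 3 ≤ k) {β : Ptn k} : β ∈ E₁ k ↔ β.part = (two k).fn := by
  constructor
  · rintro ⟨h₁, h₂⟩
    have hz : β.part 1 ≠ 0 := fun h => by
      have e := β.pre_eq_of_part_eq_zero h
      rw [pre_succ, pre_zero, h₁] at e
      omega
    obtain ⟨m, hm, h₃, h₄⟩ := β.exists_run hz
    have h₅ := h₂ 1 le_rfl
    have e : β.part = (⟨2, 1, 1, m, 0, 0⟩ : RunCode).fn := funext fun i => by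
      simp only [fn]
      split_ifs with c₁ c₂ c₃
      · obtain rfl : i = 0 := by omega
        exact h₁
      · rw [h₃ i (by omega) (by omega)]
        omega
      · omega
      · have := β.anti (show 1 + m ≤ i by omega)
        omega
    have ht := total_eq e
    simp only [total] at ht
    rw [e, two, show m = k - 2 by omega]
  · intro h
    simp only [E₁, Set.mem_ofPred_eq, h, two, fn_mk]
    refine ⟨by simp, fun i hi => ?_⟩
    split_ifs <;> omega

theorem mem_E₂_iff {β : Ptn k} : β ∈ E₂ k ↔ ∃ m, 1 ≤ m ∧ 3 * m < k ∧ β.part = (threes k m).fn := by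
  constructor
  · rintro ⟨m, l, hm, hl, h₁, h₂, h₃⟩
    have e : β.part = (⟨3, m, 1, l, 0, 0⟩ : RunCode).fn := funext fun i => by
      simp only [fn]
      split_ifs with c₁ c₂ c₃
      · exact h₁ i c₁
      · exact h₂ i (by omega) c₂
      all_goals exact h₃ i (by omega)
    have ht := total_eq e
    simp only [total] at ht
    refine ⟨m, hm, by omega, ?_⟩
    rw [e, threes, show k - 3 * m = l by omega]
  · rintro ⟨m, hm, h₁, h⟩
    refine ⟨m, k - 3 * m, hm, by omega, fun i hi => ?_, fun i hi hi' => ?_, fun i hi => ?_⟩ <;>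
      rw [h, threes, fn_mk]
    · rw [if_pos hi]
    · rw [if_neg (by omega), if_pos hi']
    · rw [if_neg (by omega), if_neg (by omega), if_neg (by omega)]

/-- On join-irreducible partitions the conditions for columns one, two and `l + 2` are exhaustive
and mutually exclusive, and together they describe `child`. -/
theorem mem_recStep_iff (hk : 3 ≤ k) {X : Set (Ptn k)} (hX : X ⊆ J k) {β : Ptn (k + 1)} :
    β ∈ recStep k X ↔ (∃ α ∈ X, β.part = α.code.child.fn) ∨ β.part = (two (k + 1)).fn ∨
      ∃ m, 1 ≤ m ∧ 3 * m < k + 1 ∧ β.part = (threes (k + 1) m).fn := by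
  rw [← mem_E₁_iff (by omega), ← mem_E₂_iff]
  have key : (β ∈ recStep k X) ↔
      ((((∃ α ∈ X, (Cl α.part ∨ NP α.part) ∧ β.part = addGrain 0 α.part) ∨
        (∃ α ∈ X, (Ss α.part ∨ NS α.part) ∧ β.part = addGrain 1 α.part)) ∨
        ∃ l, (1 ≤ l ∧ l < k) ∧ ∃ α ∈ X, PP l α.part ∧ β.part = addGrain (l + 1) α.part) ∨
        (β ∈ E₁ (k + 1) ∨ β ∈ E₂ (k + 1))) := by
    simp only [recStep, down, Set.mem_union, Set.mem_iUnion, Set.mem_ofPred_eq, Set.mem_inter_iff,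
      Finset.mem_Ico, exists_prop, or_and_right, and_or_left, exists_or, and_assoc, or_assoc]
  rw [key]
  refine or_congr ⟨?_, ?_⟩ Iff.rfl
  · rintro ((⟨α, hα, h, e⟩ | ⟨α, hα, h, e⟩) | ⟨l, hl, α, hα, h, e⟩) <;>
      obtain ⟨hc, hf⟩ := code_spec (hX hα) <;> refine ⟨α, hα, ?_⟩ <;> rw [e]
    · have := (Cl_or_NP_iff hc hf).1 h
      conv_lhs => rw [hf]
      exact addGrain_zero_of_code hc this
    · have := (Ss_or_NS_iff hc hf).1 h
      conv_lhs => rw [hf]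
      rw [← addGrain_of_code hc this.1, this.2]
    · have := (PP_iff hc hf).1 h
      conv_lhs => rw [hf]
      rw [← addGrain_of_code hc this.1, this.2.1]
  · rintro ⟨α, hα, e⟩
    obtain ⟨hc, hf⟩ := code_spec (hX hα)
    by_cases h₁ : α.code.h₂ + 1 < α.code.h₁
    · refine Or.inl (Or.inl ⟨α, hα, (Cl_or_NP_iff hc hf).2 h₁, ?_⟩)
      conv_rhs => rw [hf]
      rw [e, addGrain_zero_of_code hc h₁]
    have h₂ : α.code.h₁ = α.code.h₂ + 1 := by
      have := hc.lt
      omega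
    have h₃ := hc.2.1
    have h₄ := hc.length_le
    rw [← addGrain_of_code hc h₂] at e
    by_cases h₅ : α.code.m₁ = 1
    · refine Or.inl (Or.inr ⟨α, hα, (Ss_or_NS_iff hc hf).2 ⟨h₂, h₅⟩, ?_⟩)
      conv_rhs => rw [hf]
      rw [e, h₅]
    · refine Or.inr ⟨α.code.m₁ - 1, by omega, α, hα,
        (PP_iff hc hf).2 ⟨h₂, by omega, by omega⟩, ?_⟩
      conv_rhs => rw [hf]
      rw [e, Nat.sub_add_cancel h₃]

theorem recStep_J (hk : 3 ≤ k) : recStep k (J k) = J (k + 1) := by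
  ext β
  rw [mem_recStep_iff hk subset_rfl]
  constructor
  · rintro (⟨α, hα, h⟩ | h | ⟨m, h₁, h₂, h⟩)
    · exact mem_J_iff.2 ⟨_, child_isJoin (code_spec hα).1, h⟩
    · exact mem_J_iff.2 ⟨_, two_isJoin (by omega), h⟩
    · exact mem_J_iff.2 ⟨_, threes_isJoin h₁ h₂, h⟩
  · intro h
    obtain ⟨c, hc, hf⟩ := mem_J_iff.1 h
    rcases exists_child (by omega) hc with ⟨c', hc', rfl⟩ | rfl | ⟨m, h₁, h₂, rfl⟩
    · exact Or.inl ⟨c'.toPtn hc', c'.toPtn_mem hc', by rw [code_toPtn, hf]⟩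
    · exact Or.inr (Or.inl hf)
    · exact Or.inr (Or.inr ⟨m, h₁, h₂, hf⟩)

/-- A list of codes of join-irreducible partitions comes from a list of partitions. -/
theorem exists_map_code {C : List RunCode} (hC : ∀ c ∈ C, c.IsJoin k) :
    ∃ L : List (Ptn k), (∀ α ∈ L, α ∈ J k) ∧ L.map code = C := by
  induction C with
  | nil => exact ⟨[], by simp, rfl⟩
  | cons c C ih =>
    obtain ⟨L, h₁, h₂⟩ := ih fun c' hc' => hC c' (List.mem_cons_of_mem _ hc')
    have hc := hC c List.mem_cons_self
    refine ⟨c.toPtn hc :: L, fun α hα => ?_, by rw [List.map_cons, h₂, code_toPtn hc]⟩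
    rcases List.mem_cons.1 hα with rfl | hα
    · exact c.toPtn_mem hc
    · exact h₁ α hα

theorem exists_lists_of_codes {C : List RunCode} {A : Set (Ptn k)} (hC : ∀ c ∈ C, c.IsJoin k)
    (hA : A ⊆ J k) (hn : C.Nodup) (h : ∀ α ∈ J k, α.code ∈ C ↔ α ∈ A) :
    ∃ L : List (Ptn k), Lists L A ∧ L.map code = C := by
  obtain ⟨L, h₁, h₂⟩ := exists_map_code hC
  refine ⟨L, ⟨List.Nodup.of_map _ (h₂ ▸ hn), fun α => ⟨fun hα => ?_, fun hα => ?_⟩⟩, h₂⟩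
  · exact (h α (h₁ α hα)).1 (h₂ ▸ List.mem_map_of_mem hα)
  · have := (h α (hA hα)).2 hα
    rw [← h₂, List.mem_map] at this
    obtain ⟨β, hβ, e⟩ := this
    rwa [← code_injOn (h₁ β hβ) (hA hα) e]

/-- The set `X` is arbitrary, as the step program has to handle every stored list. No repetitions
arise because `child` is injective and misses the exceptional codes. -/
theorem exists_lists_recStep (hk : 3 ≤ k) {X : Set (Ptn k)} (hX : X ⊆ J k) {L : List (Ptn k)}
    (hL : Lists L X) : ∃ L' : List (Ptn (k + 1)), Lists L' (recStep k X) ∧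
      L'.map code = stepList k (L.map code) := by
  have hC : ∀ c ∈ L.map code, c.IsJoin k := fun c hc => by
    obtain ⟨α, hα, rfl⟩ := List.mem_map.1 hc
    exact (code_spec (hX ((hL.2 α).1 hα))).1
  have hsub : recStep k X ⊆ J (k + 1) := fun β hβ => by
    rw [mem_recStep_iff hk hX] at hβ
    rw [← recStep_J hk, mem_recStep_iff hk subset_rfl]
    exact hβ.imp_left fun ⟨α, hα, h⟩ => ⟨α, hX hα, h⟩
  refine exists_lists_of_codes (fun c => isJoin_of_mem_stepList (by omega) hC) hsub
    (nodup_stepList hC (hL.1.map_on fun α hα β hβ e =>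
      code_injOn (hX ((hL.2 α).1 hα)) (hX ((hL.2 β).1 hβ)) e)) fun β hβ => ?_
  have hcode : ∀ c : RunCode, c.IsJoin (k + 1) → (β.code = c ↔ β.part = c.fn) := fun c hc =>
    ⟨fun h => h ▸ (code_spec hβ).2, code_eq hc⟩
  rw [mem_recStep_iff hk hX, mem_stepList]
  refine or_congr ?_ (or_congr (hcode _ (two_isJoin (by omega))) (exists_congr fun m => ?_))
  · simp only [List.mem_map, exists_exists_and_eq_and, hL.2]
    refine exists_congr fun α => and_congr_right fun hα => ?_
    rw [eq_comm]
    exact hcode _ (child_isJoin (code_spec (hX hα)).1)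
  · exact and_congr_right fun h₁ => and_congr_right fun h₂ => hcode _ (threes_isJoin h₁ h₂)

/-- A complete list of codes comes from a list of all join-irreducible partitions. -/
theorem exists_lists_J_of_forall {C : List RunCode} (hC : ∀ c ∈ C, c.IsJoin k) (hn : C.Nodup)
    (h : ∀ c : RunCode, c.IsJoin k → c ∈ C) :
    ∃ L : List (Ptn k), Lists L (J k) ∧ L.map code = C :=
  exists_lists_of_codes hC subset_rfl hn fun _ hα => iff_of_true (h _ (code_spec hα).1) hα

/-- The codes of the join-irreducible partitions of `k`, for `k ≤ 3`. -/
def initList (k : ℕ) : List RunCode :=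
  if k < 2 then [] else if k < 3 then [⟨2, 1, 0, 0, 0, 0⟩] else
    [⟨3, 1, 0, 0, 0, 0⟩, ⟨2, 1, 1, 1, 0, 0⟩]

theorem exists_lists_initList (hk : k ≤ 3) :
    ∃ L : List (Ptn k), Lists L (J k) ∧ L.map code = initList k := by
  refine exists_lists_J_of_forall (fun c hc => ?_) ?_ fun c hc => ?_
  · rw [initList] at hc
    split_ifs at hc with h₁ h₂
    · simp at hc
    · obtain rfl : k = 2 := by omega
      obtain rfl := List.mem_singleton.1 hc
      simp [IsJoin, total]
    · obtain rfl : k = 3 := by omega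
      simp only [List.mem_cons, List.not_mem_nil, or_false] at hc
      rcases hc with rfl | rfl <;> simp [IsJoin, total]
  · rw [initList]
    split_ifs <;> simp
  · have hlen := hc.length_le
    obtain ⟨h₁, m₁, h₂, m₂, h₃, m₃⟩ := c
    obtain ⟨ht, hm, hc⟩ := hc
    simp only [total] at ht hm hc hlen
    have : m₁ ≤ 3 := by omega
    have : m₂ ≤ 2 := by omega
    have : m₃ ≤ 2 := by omega
    rw [initList]
    split_ifs <;> simp only [List.mem_cons, List.not_mem_nil, or_false, RunCode.mk.injEq] <;>
      interval_cases m₁ <;> interval_cases m₂ <;> interval_cases m₃ <;> omega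

/-- The number of join-irreducible partitions grows quadratically. -/
theorem exists_lists_J (hk : 3 ≤ k) :
    ∃ L : List (Ptn k), Lists L (J k) ∧ L.length ≤ k ^ 2 ∧ k ^ 2 ≤ 12 * L.length := by
  induction k, hk using Nat.le_induction with
  | base =>
    obtain ⟨L, h₁, h₂⟩ := exists_lists_initList (k := 3) le_rfl
    have h₃ := congrArg List.length h₂
    simp [initList] at h₃
    exact ⟨L, h₁, by omega, by omega⟩
  | succ k hk ih =>
    obtain ⟨L, h₁, h₂, h₃⟩ := ih
    obtain ⟨L', h₄, h₅⟩ := exists_lists_recStep hk subset_rfl h₁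
    have h₆ := congrArg List.length h₅
    rw [length_stepList, List.length_map, List.length_map] at h₆
    rw [recStep_J hk] at h₄
    -- The growth `1 + k / 3` lies between a twelfth of `2 * k + 1` and `2 * k + 1`.
    have h₇ : (k + 1) ^ 2 = k ^ 2 + (2 * k + 1) := by ring
    exact ⟨L', h₄, by omega, by omega⟩

end Ptn

/-! ## The programs -/

open RunCode RamProg

/-- The record of six words at address `p`. -/
def codeAt (mem : ℕ → ℕ) (p : ℕ) : RunCode :=
  ⟨mem p, mem (p + 1), mem (p + 2), mem (p + 3), mem (p + 4), mem (p + 5)⟩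

/-- The machine holds a list of codes. -/
def HoldsCodes (n k : ℕ) (C : List RunCode) (s : RamState) : Prop :=
  s.reg 0 = n ∧ s.reg 1 = k ∧ s.reg 2 = C.length ∧ s.out = [] ∧
    ∀ (i : ℕ) (hi : i < C.length), codeAt s.mem (6 * i) = C[i]

theorem holds_iff {n k : ℕ} {L : List (Ptn k)} {s : RamState} :
    Holds n k L s ↔ HoldsCodes n k (L.map code) s := by
  simp only [Holds, HoldsCodes, List.length_map, List.getElem_map, runs_eq]
  refine and_congr_right fun _ => and_congr_right fun _ => and_congr_right fun _ =>
    and_congr_right fun _ => forall_congr' fun i => forall_congr' fun hi => ?_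
  constructor
  · intro h
    have h₀ := h 0
    have h₁ := h 1
    have h₂ := h 2
    have h₃ := h 3
    have h₄ := h 4
    have h₅ := h 5
    simp [toList] at h₀ h₁ h₂ h₃ h₄ h₅
    ext <;> simp only [codeAt] <;> assumption
  · intro h j hj
    rw [← h]
    interval_cases j <;> rfl

namespace RunCode

/-- All entries of a code are small. -/
theorem IsJoin.entries_le {n : ℕ} {c : RunCode} (h : c.IsJoin n) :
    c.h₁ ≤ n ∧ c.m₁ ≤ n ∧ c.h₂ ≤ n ∧ c.m₂ ≤ n ∧ c.h₃ ≤ n ∧ c.m₃ ≤ n ∧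
      c.m₁ * c.h₁ ≤ n ∧ c.m₂ * c.h₂ ≤ n ∧ c.m₃ * c.h₃ ≤ n := by
  have h₁ := h.length_le
  have h₂ := h.lt
  have h₃ : c.h₁ ≤ c.m₁ * c.h₁ := Nat.le_mul_of_pos_left _ h.2.1
  have h₄ : _ = _ := h.1
  rw [total] at h₄
  omega

end RunCode

namespace RamProg

/-- Sequential composition of a list of programs. -/
def block : List RamProg → RamProg
  | [] => skip
  | p :: l => seq p (block l)

/-- The `j`-th word of the record to which register `r` points. -/
def fld (r j : ℕ) : RamExpr := .load (.add (.reg r) (.lit j))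

/-- Write the `j`-th word of the record to which register `3` points. -/
def put (j : ℕ) (e : RamExpr) : RamProg := .store (.add (.reg 3) (.lit j)) e

/-- Write the record to which register `3` points. -/
def putCode (a b c d e f : RamExpr) : RamProg :=
  block [put 0 a, put 1 b, put 2 c, put 3 d, put 4 e, put 5 f]

theorem codeAt_congr {m m' : ℕ → ℕ} {p : ℕ} (h : ∀ a, p ≤ a → a < p + 6 → m a = m' a) :
    codeAt m p = codeAt m' p := by
  ext <;> exact h _ (by omega) (by omega)

/-- The words are overwritten one after another, so `hv` demands values that do not depend on the
memory. -/
theorem wp_putCode {W p : ℕ} {a b c d e f : RamExpr} {x : RunCode} {s : RamState}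
    {Q : RamState → Prop} (hp : s.reg 3 = p) (hW : p + 5 ≤ W)
    (hv : ∀ m, (a.Fits W ⟨s.reg, m, s.out⟩ ∧ b.Fits W ⟨s.reg, m, s.out⟩ ∧
      c.Fits W ⟨s.reg, m, s.out⟩ ∧ d.Fits W ⟨s.reg, m, s.out⟩ ∧ e.Fits W ⟨s.reg, m, s.out⟩ ∧
      f.Fits W ⟨s.reg, m, s.out⟩) ∧ a.eval ⟨s.reg, m, s.out⟩ = x.h₁ ∧
      b.eval ⟨s.reg, m, s.out⟩ = x.m₁ ∧ c.eval ⟨s.reg, m, s.out⟩ = x.h₂ ∧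
      d.eval ⟨s.reg, m, s.out⟩ = x.m₂ ∧ e.eval ⟨s.reg, m, s.out⟩ = x.h₃ ∧
      f.eval ⟨s.reg, m, s.out⟩ = x.m₃)
    (hQ : ∀ m, codeAt m p = x → (∀ q, q < p ∨ p + 6 ≤ q → m q = s.mem q) →
      Q ⟨s.reg, m, s.out⟩) : (putCode a b c d e f).Wp W Q s := by
  have key : ∀ (j : ℕ) (y : RamExpr) (v : ℕ) (R : RamState → Prop) (m : ℕ → ℕ), j ≤ 5 →
      y.Fits W ⟨s.reg, m, s.out⟩ → y.eval ⟨s.reg, m, s.out⟩ = v →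
      R ⟨s.reg, Function.update m (p + j) v, s.out⟩ → (put j y).Wp W R ⟨s.reg, m, s.out⟩ := by
    intro j y v R m hj hf hy hR
    refine ⟨⟨?_, ?_, ?_⟩, hf, ?_⟩
    · change s.reg 3 ≤ W
      omega
    · change j ≤ W
      omega
    · change s.reg 3 + j ≤ W
      omega
    · simpa only [RamExpr.eval, hp, hy] using hR
  refine key 0 a x.h₁ _ _ (by omega) (hv _).1.1 (hv _).2.1 ?_
  refine key 1 b x.m₁ _ _ (by omega) (hv _).1.2.1 (hv _).2.2.1 ?_
  refine key 2 c x.h₂ _ _ (by omega) (hv _).1.2.2.1 (hv _).2.2.2.1 ?_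
  refine key 3 d x.m₂ _ _ (by omega) (hv _).1.2.2.2.1 (hv _).2.2.2.2.1 ?_
  refine key 4 e x.h₃ _ _ (by omega) (hv _).1.2.2.2.2.1 (hv _).2.2.2.2.2.1 ?_
  refine key 5 f x.m₃ _ _ (by omega) (hv _).1.2.2.2.2.2 (hv _).2.2.2.2.2.2 ?_
  refine hQ _ ?_ fun q hq => ?_
  · ext <;> simp [codeAt]
  · simp only [Function.update_apply]
    repeat rw [if_neg (by omega)]

/-! ### Initialisation -/

/-- Store the list of join-irreducible partitions of `min n 3`. -/
def initProg : RamProg :=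
  .ite (.lt (.reg 0) (.lit 2)) (.assign 1 (.lit 1))
    (.ite (.lt (.reg 0) (.lit 3))
      -- Words not written here are zero in the initial memory.
      (block [.assign 1 (.lit 2), .assign 2 (.lit 1), .store (.lit 0) (.lit 2),
        .store (.lit 1) (.lit 1)])
      (block [.assign 1 (.lit 3), .assign 2 (.lit 2), .store (.lit 0) (.lit 3),
        .store (.lit 1) (.lit 1), .store (.lit 6) (.lit 2), .store (.lit 7) (.lit 1),
        .store (.lit 8) (.lit 1), .store (.lit 9) (.lit 1)]))

theorem wp_initProg {W n : ℕ} (hn : 1 ≤ n) (hnW : n ≤ W) (hW : 9 ≤ W) :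
    initProg.Wp W (HoldsCodes n (min n 3) (initList (min n 3))) (ramInput n) := by
  have h₀ : ∀ c ≤ 9, c ≤ W := fun c hc => hc.trans hW
  rcases Nat.lt_or_ge n 2 with h | h
  · obtain rfl : n = 1 := by omega
    simp [initProg, Wp, RamExpr.Fits, RamExpr.eval, ramInput, h₀, HoldsCodes, initList]
  rcases Nat.lt_or_ge n 3 with h' | h'
  · obtain rfl : n = 2 := by omega
    simp [initProg, Wp, RamExpr.Fits, RamExpr.eval, ramInput, h₀, HoldsCodes, initList, block,
      codeAt, Function.update_apply]
  · have e₁ : ¬ n < 2 := by omega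
    have e₂ : ¬ n < 3 := by omega
    simp [initProg, Wp, RamExpr.Fits, RamExpr.eval, ramInput, h₀, HoldsCodes, initList, block,
      hnW, e₁, e₂, h']
    intro i hi
    interval_cases i <;> simp [codeAt]

/-! ### The recursion step -/

/-- Replace the record to which register `3` points by its child. -/
def childProg : RamProg :=
  -- The whole record is loaded first because it is overwritten in place.
  block [.assign 4 (fld 3 0), .assign 5 (fld 3 1), .assign 6 (fld 3 2), .assign 7 (fld 3 3),
    .assign 8 (fld 3 4), .assign 9 (fld 3 5),
    .ite (.lt (.add (.reg 6) (.lit 1)) (.reg 4))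
      (.ite (.lt (.reg 5) (.lit 2))
        (putCode (.add (.reg 4) (.lit 1)) (.lit 1) (.reg 6) (.reg 7) (.reg 8) (.reg 9))
        (putCode (.add (.reg 4) (.lit 1)) (.lit 1) (.reg 4) (.sub (.reg 5) (.lit 1)) (.reg 6)
          (.reg 7)))
      (.ite (.lt (.reg 7) (.lit 2))
        (putCode (.reg 4) (.add (.reg 5) (.lit 1)) (.reg 8) (.reg 9) (.lit 0) (.lit 0))
        (putCode (.reg 4) (.add (.reg 5) (.lit 1)) (.reg 6) (.sub (.reg 7) (.lit 1)) (.reg 8)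
          (.reg 9))),
    .assign 3 (.add (.reg 3) (.lit 6))]

theorem wp_childProg {W p k : ℕ} {x : RunCode} {s : RamState} {Q : RamState → Prop}
    (hp : s.reg 3 = p) (hx : codeAt s.mem p = x) (hk : x.IsJoin k) (hW : p + k + 10 ≤ W)
    (hQ : ∀ s' : RamState, codeAt s'.mem p = x.child →
      (∀ q, q < p ∨ p + 6 ≤ q → s'.mem q = s.mem q) → s'.out = s.out →
      s'.reg 0 = s.reg 0 → s'.reg 1 = s.reg 1 → s'.reg 2 = s.reg 2 → s'.reg 3 = p + 6 → Q s') :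
    childProg.Wp W Q s := by
  have hl := hk.entries_le
  obtain ⟨h₁, m₁, h₂, m₂, h₃, m₃⟩ := x
  simp only [codeAt, RunCode.mk.injEq] at hx
  obtain ⟨x₁, x₂, x₃, x₄, x₅, x₆⟩ := hx
  simp only at hl
  have hc : ∀ c ≤ 10, c ≤ W := fun c hc => by omega
  have hpW : ∀ c ≤ 10, p + c ≤ W := fun c hc => by omega
  simp only [childProg, block, Wp, fld, RamExpr.Fits, RamExpr.eval, Function.update_apply, hp,
    Nat.reduceEqDiff, if_true, if_false, Nat.add_zero, x₁, x₂, x₃, x₄, x₅, x₆]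
  simp (disch := omega) only [hc, hpW, true_and, and_true]
  set R := Function.update (Function.update (Function.update (Function.update (Function.update
    (Function.update s.reg 4 h₁) 5 m₁) 6 h₂) 7 m₂) 8 h₃) 9 m₃ with hR
  have hR3 : R 3 = p := by simp [hR, hp]
  have main : ∀ a b c d e f : RamExpr, (∀ m, (a.Fits W ⟨R, m, s.out⟩ ∧
      b.Fits W ⟨R, m, s.out⟩ ∧ c.Fits W ⟨R, m, s.out⟩ ∧ d.Fits W ⟨R, m, s.out⟩ ∧
      e.Fits W ⟨R, m, s.out⟩ ∧ f.Fits W ⟨R, m, s.out⟩) ∧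
      (⟨a.eval ⟨R, m, s.out⟩, b.eval ⟨R, m, s.out⟩, c.eval ⟨R, m, s.out⟩, d.eval ⟨R, m, s.out⟩,
        e.eval ⟨R, m, s.out⟩, f.eval ⟨R, m, s.out⟩⟩ : RunCode) =
        child ⟨h₁, m₁, h₂, m₂, h₃, m₃⟩) →
      (putCode a b c d e f).Wp W (fun x => (x.reg 3 ≤ W ∧ x.reg 3 + 6 ≤ W) ∧
        Q ⟨Function.update x.reg 3 (x.reg 3 + 6), x.mem, x.out⟩) ⟨R, s.mem, s.out⟩ := by
    intro a b c d e f h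
    refine wp_putCode (x := child ⟨h₁, m₁, h₂, m₂, h₃, m₃⟩) hR3 (by omega) (fun m => ⟨(h m).1, ?_⟩) fun m h₁ h₂ => ?_
    · rw [← (h m).2]
      exact ⟨rfl, rfl, rfl, rfl, rfl, rfl⟩
    · exact ⟨by simp only [hR3]; omega, hQ _ h₁ h₂ rfl (by simp [hR]) (by simp [hR])
        (by simp [hR]) (by simp [hR3])⟩
  have r₄ : R 4 = h₁ := by simp [hR]
  have r₅ : R 5 = m₁ := by simp [hR]
  have r₆ : R 6 = h₂ := by simp [hR]
  have r₇ : R 7 = m₂ := by simp [hR]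
  have r₈ : R 8 = h₃ := by simp [hR]
  have r₉ : R 9 = m₃ := by simp [hR]
  clear_value R
  refine ⟨by omega, by omega, by omega, by omega, by omega, by omega, by omega, fun c₁ =>
    ⟨by omega, fun c₂ => main _ _ _ _ _ _ fun m => ?_, fun c₂ => main _ _ _ _ _ _ fun m => ?_⟩,
    fun c₁ => ⟨by omega, fun c₂ => main _ _ _ _ _ _ fun m => ?_,
      fun c₂ => main _ _ _ _ _ _ fun m => ?_⟩⟩
  · rw [child_mk, if_pos (by_contra fun h => c₁ (if_neg h)),
      if_pos (by_contra fun h => c₂ (if_neg h))]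
    simp only [RamExpr.Fits, RamExpr.eval, r₄, r₆, r₇, r₈, r₉, and_true]
    omega
  · rw [child_mk, if_pos (by_contra fun h => c₁ (if_neg h)),
      if_neg fun h => one_ne_zero ((if_pos h).symm.trans c₂)]
    simp only [RamExpr.Fits, RamExpr.eval, r₄, r₅, r₆, r₇, and_true]
    omega
  · rw [child_mk, if_neg fun h => one_ne_zero ((if_pos h).symm.trans c₁),
      if_pos (by_contra fun h => c₂ (if_neg h))]
    simp only [RamExpr.Fits, RamExpr.eval, r₄, r₅, r₈, r₉, and_true]
    omega
  · rw [child_mk, if_neg fun h => one_ne_zero ((if_pos h).symm.trans c₁),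
      if_neg fun h => one_ne_zero ((if_pos h).symm.trans c₂)]
    simp only [RamExpr.Fits, RamExpr.eval, r₄, r₅, r₆, r₇, r₈, r₉, and_true]
    omega

/-- One step of the recursion. -/
def stepProg : RamProg :=
  .seq (.assign 3 (.lit 0))
    (.seq (.loop (.lt (.reg 3) (.mul (.lit 6) (.reg 2))) childProg)
      (.seq (.seq (putCode (.lit 2) (.lit 1) (.lit 1) (.sub (.reg 1) (.lit 1)) (.lit 0) (.lit 0))
          (block [.assign 3 (.add (.reg 3) (.lit 6)), .assign 4 (.lit 1)]))
        (.seq (.loop (.lt (.mul (.lit 3) (.reg 4)) (.add (.reg 1) (.lit 1)))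
            (.seq (putCode (.lit 3) (.reg 4) (.lit 1)
                (.sub (.add (.reg 1) (.lit 1)) (.mul (.lit 3) (.reg 4))) (.lit 0) (.lit 0))
              (block [.assign 3 (.add (.reg 3) (.lit 6)), .assign 4 (.add (.reg 4) (.lit 1))])))
          -- Register `4` now holds `k / 3 + 1`, the number of exceptional codes appended.
          (block [.assign 2 (.add (.reg 2) (.reg 4)), .assign 1 (.add (.reg 1) (.lit 1))]))))

theorem codeAt_eq_of_agree {m m' : ℕ → ℕ} {p q : ℕ}
    (h : ∀ a, a < p ∨ p + 6 ≤ a → m' a = m a) (hq : q + 6 ≤ p ∨ p + 6 ≤ q) :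
    codeAt m' q = codeAt m q :=
  codeAt_congr fun a h₁ h₂ => h a (by omega)

/-- A factor for the running time of `stepProg`. -/
def stepTime : ℕ := childProg.size + 200

theorem runs_stepProg {W n k : ℕ} {C : List RunCode} {s : RamState} (hk : 3 ≤ k) (hkn : k ≤ n)
    (hC : ∀ c ∈ C, c.IsJoin k) (hCk : C.length ≤ k ^ 2) (hW : 6 * C.length + 10 * n + 30 ≤ W)
    (hs : HoldsCodes n k C s) :
    stepProg.Runs W s (stepTime * k ^ 2) (HoldsCodes n (k + 1) (stepList k C)) := by
  obtain ⟨s₀, s₁, s₂, s₃, s₄⟩ := hs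
  have hlen := length_stepList k C
  have hk₃ : k / 3 ≤ k := Nat.div_le_self k 3
  have d₁ : ∀ i (hi : i < C.length), (stepList k C)[i]'(by omega) = C[i].child := fun i hi => by
    simp [stepList, List.getElem_append_left, hi]
  have d₂ : (stepList k C)[C.length]'(by omega) = two (k + 1) := by
    simp [stepList]
  have d₃ : ∀ i (hi : i < k / 3),
      (stepList k C)[C.length + 1 + i]'(by omega) = threes (k + 1) (i + 1) := fun i hi => by
    simp [stepList, List.getElem_append_right, add_assoc, add_comm 1 i]
  -- First loop: the records before `i` are already children, those from `i` on are untouched.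
  let I : ℕ → RamState → Prop := fun i s' => s'.reg 0 = n ∧ s'.reg 1 = k ∧
    s'.reg 2 = C.length ∧ s'.out = [] ∧ s'.reg 3 = 6 * i ∧
    (∀ j (hj : j < i) (hj' : j < (stepList k C).length), codeAt s'.mem (6 * j) = (stepList k C)[j]) ∧
    ∀ j (hj : j < C.length), i ≤ j → codeAt s'.mem (6 * j) = C[j]
  -- Second loop: behind the children stand `two` and `i` codes `threes`; register `4` is the next
  -- number of threes.
  let K : ℕ → RamState → Prop := fun i s' => s'.reg 0 = n ∧ s'.reg 1 = k ∧
    s'.reg 2 = C.length ∧ s'.out = [] ∧ s'.reg 3 = 6 * (C.length + 1 + i) ∧ s'.reg 4 = i + 1 ∧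
    ∀ j (hj : j < C.length + 1 + i) (hj' : j < (stepList k C).length),
      codeAt s'.mem (6 * j) = (stepList k C)[j]
  have h₁ : (assign 3 (.lit 0)).Runs W s 2 (I 0) :=
    Wp.runs (p := assign 3 (.lit 0)) ⟨Nat.zero_le _, by simpa using s₀, by simpa using s₁,
      by simpa using s₂, s₃, by simp [RamExpr.eval], fun j hj => absurd hj (Nat.not_lt_zero j),
      fun j hj _ => s₄ j hj⟩
  have h₂ : ∀ s', I 0 s' → (loop (.lt (.reg 3) (.mul (.lit 6) (.reg 2))) childProg).Runs W s'
      (C.length * (6 + childProg.size) + 6) (I C.length) := by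
    refine fun s' hs' => Runs.loop I C.length childProg.size ?_ ?_ hs'
    · rintro i hi t ⟨t₀, t₁, t₂, t₃, t₄, t₅, t₆⟩
      refine ⟨?_, ?_, Wp.runs (wp_childProg t₄ (t₆ i hi le_rfl) (hC _ (List.getElem_mem hi))
        (by omega) fun u u₁ u₂ u₃ u₄ u₅ u₆ u₇ => ⟨u₄.trans t₀, u₅.trans t₁, u₆.trans t₂,
          u₃.trans t₃, u₇, fun j hj hj' => ?_, fun j hj hj' => ?_⟩)⟩
      · simp only [RamExpr.Fits, RamExpr.eval, t₄, t₂]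
        omega
      · simp only [RamExpr.eval, t₄, t₂]
        rw [if_pos (by omega)]
        exact one_ne_zero
      · rcases Nat.lt_succ_iff_lt_or_eq.1 hj with hj | rfl
        · rw [codeAt_eq_of_agree u₂ (by omega), t₅ j hj hj']
        · rw [u₁, d₁ j hi]
      · rw [codeAt_eq_of_agree u₂ (by omega), t₆ j hj (by omega)]
    · rintro t ⟨t₀, t₁, t₂, t₃, t₄, t₅, t₆⟩
      simp only [RamExpr.Fits, RamExpr.eval, t₄, t₂]
      rw [if_neg (lt_irrefl _)]
      omega
  have h₃ : ∀ s', I C.length s' → (RamProg.seq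
      (putCode (.lit 2) (.lit 1) (.lit 1) (.sub (.reg 1) (.lit 1)) (.lit 0) (.lit 0))
      (block [.assign 3 (.add (.reg 3) (.lit 6)), .assign 4 (.lit 1)])).Runs W s' 50 (K 0) := by
    rintro t ⟨t₀, t₁, t₂, t₃, t₄, t₅, t₆⟩
    refine (Wp.runs (W := W) (Q := K 0) ?_).mono (by simp [size, putCode, put, block,
      RamExpr.cost]) fun _ h => h
    refine wp_putCode (x := two (k + 1)) t₄ (by omega) (fun m => ?_) fun m m₁ m₂ => ?_
    · simp only [RamExpr.Fits, RamExpr.eval, t₁, two, and_true, true_and]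
      omega
    · simp only [block, Wp, RamExpr.Fits, RamExpr.eval, t₄]
      refine ⟨by omega, by omega, by simpa using t₀, by simpa using t₁, by simpa using t₂, t₃,
        by simp; omega, by simp, fun j hj hj' => ?_⟩
      rcases Nat.lt_succ_iff_lt_or_eq.1 hj with hj | rfl
      · rw [codeAt_eq_of_agree m₂ (by omega), t₅ j hj hj']
      · rw [m₁, d₂]
  have h₄ : ∀ s', K 0 s' → (loop (.lt (.mul (.lit 3) (.reg 4)) (.add (.reg 1) (.lit 1)))
      (.seq (putCode (.lit 3) (.reg 4) (.lit 1)
          (.sub (.add (.reg 1) (.lit 1)) (.mul (.lit 3) (.reg 4))) (.lit 0) (.lit 0))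
        (block [.assign 3 (.add (.reg 3) (.lit 6)),
          .assign 4 (.add (.reg 4) (.lit 1))]))).Runs W s' (k / 3 * (8 + 80) + 8) (K (k / 3)) := by
    refine fun s' hs' => Runs.loop K (k / 3) 80 ?_ ?_ hs'
    · rintro i hi t ⟨t₀, t₁, t₂, t₃, t₄, t₅, t₆⟩
      refine ⟨?_, ?_, (Wp.runs (W := W) (Q := K (i + 1)) ?_).mono (by simp [size, putCode, put,
        block, RamExpr.cost]) fun _ h => h⟩
      · simp only [RamExpr.Fits, RamExpr.eval, t₅, t₁]
        omega
      · simp only [RamExpr.eval, t₅, t₁]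
        rw [if_pos (by omega)]
        exact one_ne_zero
      · refine wp_putCode (x := threes (k + 1) (i + 1)) t₄ (by omega) (fun m => ?_)
          fun m m₁ m₂ => ?_
        · simp only [RamExpr.Fits, RamExpr.eval, t₁, t₅, threes, and_true]
          omega
        · simp only [block, Wp, RamExpr.Fits, RamExpr.eval, t₄]
          refine ⟨by omega, by simp [t₅]; omega, by simpa using t₀, by simpa using t₁,
            by simpa using t₂, t₃, by simp; omega, by simp [t₅], fun j hj hj' => ?_⟩
          rcases (show j < C.length + 1 + i ∨ j = C.length + 1 + i by omega) with hj | rfl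
          · rw [codeAt_eq_of_agree m₂ (by omega), t₆ j hj hj']
          · exact m₁.trans (d₃ i hi).symm
    · rintro t ⟨t₀, t₁, t₂, t₃, t₄, t₅, t₆⟩
      simp only [RamExpr.Fits, RamExpr.eval, t₅, t₁]
      rw [if_neg (by omega)]
      omega
  have h₅ : ∀ s', K (k / 3) s' → (block [.assign 2 (.add (.reg 2) (.reg 4)),
      .assign 1 (.add (.reg 1) (.lit 1))]).Runs W s' 9 (HoldsCodes n (k + 1) (stepList k C)) := by
    rintro t ⟨t₀, t₁, t₂, t₃, t₄, t₅, t₆⟩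
    refine (Wp.runs (W := W) (Q := HoldsCodes n (k + 1) (stepList k C)) ?_).mono
      (by simp [size, block, RamExpr.cost]) fun _ h => h
    simp only [block, Wp, RamExpr.Fits, RamExpr.eval, t₂, t₅]
    refine ⟨by omega, by simp [t₁]; omega, by simpa using t₀, by simp [t₁], by simp; omega, t₃,
      fun j hj => t₆ j (by omega) hj⟩
  refine (Runs.seq h₁ fun _ h => Runs.seq (h₂ _ h) fun _ h => Runs.seq (h₃ _ h) fun _ h =>
    Runs.seq (h₄ _ h) h₅).mono ?_ fun _ h => h
  -- Since `k ≥ 3`, the linear cost of the exceptional codes is absorbed by `k ^ 2`.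
  have e₁ : 3 * k ≤ k ^ 2 := by nlinarith
  have e₂ := Nat.mul_le_mul_right (6 + childProg.size) hCk
  rw [stepTime]
  nlinarith

end RamProg

namespace RamProg

/-! ### Output -/

theorem fld_spec {W r p n : ℕ} {c : RunCode} {s : RamState} (hr : s.reg r = p)
    (hc : codeAt s.mem p = c) (hn : c.IsJoin n) (hW : p + n + 5 ≤ W) :
    ((fld r 0).eval s = c.h₁ ∧ (fld r 1).eval s = c.m₁ ∧ (fld r 2).eval s = c.h₂ ∧
      (fld r 3).eval s = c.m₂ ∧ (fld r 4).eval s = c.h₃ ∧ (fld r 5).eval s = c.m₃) ∧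
    ((fld r 0).Fits W s ∧ (fld r 1).Fits W s ∧ (fld r 2).Fits W s ∧
      (fld r 3).Fits W s ∧ (fld r 4).Fits W s ∧ (fld r 5).Fits W s) := by
  have hl := hn.entries_le
  subst hc
  simp only [codeAt] at hl
  simp only [fld, RamExpr.eval, RamExpr.Fits, hr, codeAt, Nat.add_zero, true_and]
  omega

/-- Output the tuple of the partition to which register `3` points. -/
def tupleProg : RamProg :=
  .seq (rep 4 (fld 3 1) (fld 3 0)) (.seq (rep 4 (fld 3 3) (fld 3 2))
    (.seq (rep 4 (fld 3 5) (fld 3 4))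
      (rep 4 (.sub (.reg 0) (.add (.add (fld 3 1) (fld 3 3)) (fld 3 5))) (.lit 0))))

/-- Output the tuple of the conjugate of the partition to which register `3` points. -/
def conjProg : RamProg :=
  .seq (rep 4 (fld 3 4) (.add (.add (fld 3 1) (fld 3 3)) (fld 3 5)))
    (.seq (rep 4 (.sub (fld 3 2) (fld 3 4)) (.add (fld 3 1) (fld 3 3)))
      (.seq (rep 4 (.sub (fld 3 0) (fld 3 2)) (fld 3 1))
        (rep 4 (.sub (.reg 0) (fld 3 0)) (.lit 0))))

theorem emits_tupleProg {W n p : ℕ} {α : Ptn n} {s : RamState} (hα : α ∈ J n)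
    (h0 : s.reg 0 = n) (h3 : s.reg 3 = p) (hc : codeAt s.mem p = α.code)
    (hW : p + n + 5 ≤ W) : tupleProg.Emits W 4 s (100 + 100 * n) α.tuple := by
  obtain ⟨hj, hf⟩ := code_spec hα
  have hl := hj.entries_le
  have hlen := hj.length_le
  have spec : ∀ s' : RamState, s'.mem = s.mem → (∀ i < 4, s'.reg i = s.reg i) → _ :=
    fun s' hm hr => fld_spec (W := W) ((hr 3 (by omega)).trans h3) (hm ▸ hc) hj hW
  have reg0 : ∀ s' : RamState, (∀ i < 4, s'.reg i = s.reg i) → s'.reg 0 = n :=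
    fun s' hr => (hr 0 (by omega)).trans h0
  rw [tuple_of_code hj hf]
  refine Emits.mono (Emits.seq (T₁ := 9 + α.code.m₁ * 13) ?_ fun s₁ a₁ b₁ =>
    Emits.seq (T₁ := 9 + α.code.m₂ * 13) ?_ fun s₂ a₂ b₂ =>
    Emits.seq (T₁ := 9 + α.code.m₃ * 13) 
      (T₂ := 30 + (n - (α.code.m₁ + α.code.m₂ + α.code.m₃)) * 10) ?_ fun s₃ a₃ b₃ => ?_) le_rfl (by omega)
  · obtain ⟨⟨e₀, e₁, e₂, e₃, e₄, e₅⟩, f₀, f₁, f₂, f₃, f₄, f₅⟩ := spec s rfl fun _ _ => rfl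
    refine emits_rep (by omega) f₁ e₁ (by omega) fun s' a b => ?_
    have := spec s' a b
    exact ⟨this.2.1, this.1.1⟩
  · obtain ⟨⟨e₀, e₁, e₂, e₃, e₄, e₅⟩, f₀, f₁, f₂, f₃, f₄, f₅⟩ := spec s₁ a₁ b₁
    refine emits_rep (by omega) f₃ e₃ (by omega) fun s' a b => ?_
    have := spec s' (a.trans a₁) fun i hi => (b i hi).trans (b₁ i hi)
    exact ⟨this.2.2.2.1, this.1.2.2.1⟩
  · replace a₂ := a₂.trans a₁
    replace b₂ := fun i hi => (b₂ i hi).trans (b₁ i hi)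
    obtain ⟨⟨e₀, e₁, e₂, e₃, e₄, e₅⟩, f₀, f₁, f₂, f₃, f₄, f₅⟩ := spec s₂ a₂ b₂
    refine emits_rep (by omega) f₅ e₅ (by omega) fun s' a b => ?_
    have := spec s' (a.trans a₂) fun i hi => (b i hi).trans (b₂ i hi)
    exact ⟨this.2.2.2.2.2.1, this.1.2.2.2.2.1⟩
  · replace a₃ := a₃.trans (a₂.trans a₁)
    replace b₃ := fun i hi => (b₃ i hi).trans ((b₂ i hi).trans (b₁ i hi))
    obtain ⟨⟨e₀, e₁, e₂, e₃, e₄, e₅⟩, f₀, f₁, f₂, f₃, f₄, f₅⟩ := spec s₃ a₃ b₃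
    refine Emits.mono (emits_rep (by omega) ?_ ?_ (by omega) fun s' a b => ?_) le_rfl
      (by simp [RamExpr.cost, fld])
    · simp only [RamExpr.Fits, RamExpr.eval, reg0 s₃ b₃, e₁, e₃, e₅, f₁, f₃, f₅, true_and]
      omega
    · simp only [RamExpr.eval, reg0 s₃ b₃, e₁, e₃, e₅]
    · exact ⟨Nat.zero_le _, rfl⟩

theorem emits_conjProg {W n p : ℕ} {α : Ptn n} {s : RamState} (hα : α ∈ J n)
    (h0 : s.reg 0 = n) (h3 : s.reg 3 = p) (hc : codeAt s.mem p = α.code)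
    (hW : p + n + 5 ≤ W) : conjProg.Emits W 4 s (100 + 100 * n) α.conj.tuple := by
  obtain ⟨hj, hf⟩ := code_spec hα
  have hl := hj.entries_le
  have hlt := hj.lt
  have hlen := hj.length_le
  have spec : ∀ s' : RamState, s'.mem = s.mem → (∀ i < 4, s'.reg i = s.reg i) → _ :=
    fun s' hm hr => fld_spec (W := W) ((hr 3 (by omega)).trans h3) (hm ▸ hc) hj hW
  have reg0 : ∀ s' : RamState, (∀ i < 4, s'.reg i = s.reg i) → s'.reg 0 = n :=
    fun s' hr => (hr 0 (by omega)).trans h0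
  rw [tuple_conj_of_code hj hf]
  refine Emits.mono (Emits.seq (T₁ := 20 + α.code.h₃ * 23) ?_ fun s₁ a₁ b₁ =>
    Emits.seq (T₁ := 20 + (α.code.h₂ - α.code.h₃) * 18) ?_ fun s₂ a₂ b₂ =>
    Emits.seq (T₁ := 20 + (α.code.h₁ - α.code.h₂) * 13) (T₂ := 20 + (n - α.code.h₁) * 10)
      ?_ fun s₃ a₃ b₃ => ?_) le_rfl (by omega)
  · obtain ⟨⟨e₀, e₁, e₂, e₃, e₄, e₅⟩, f₀, f₁, f₂, f₃, f₄, f₅⟩ := spec s rfl fun _ _ => rfl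
    refine Emits.mono (emits_rep (by omega) f₄ e₄ (by omega) fun s' a b => ?_) le_rfl
      (by simp [RamExpr.cost, fld])
    obtain ⟨⟨e₀, e₁, e₂, e₃, e₄, e₅⟩, f₀, f₁, f₂, f₃, f₄, f₅⟩ := spec s' a b
    simp only [RamExpr.Fits, RamExpr.eval, e₁, e₃, e₅, f₁, f₃, f₅, true_and, and_true]
    omega
  · obtain ⟨⟨e₀, e₁, e₂, e₃, e₄, e₅⟩, f₀, f₁, f₂, f₃, f₄, f₅⟩ := spec s₁ a₁ b₁
    refine Emits.mono (emits_rep (M := α.code.h₂ - α.code.h₃) (by omega) ⟨f₂, f₄⟩ ?_ (by omega)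
      fun s' a b => ?_) le_rfl (by simp [RamExpr.cost, fld])
    · simp only [RamExpr.eval, e₂, e₄]
    obtain ⟨⟨e₀, e₁, e₂, e₃, e₄, e₅⟩, f₀, f₁, f₂, f₃, f₄, f₅⟩ :=
      spec s' (a.trans a₁) fun i hi => (b i hi).trans (b₁ i hi)
    simp only [RamExpr.Fits, RamExpr.eval, e₁, e₃, f₁, f₃, true_and, and_true]
    omega
  · replace a₂ := a₂.trans a₁
    replace b₂ := fun i hi => (b₂ i hi).trans (b₁ i hi)
    obtain ⟨⟨e₀, e₁, e₂, e₃, e₄, e₅⟩, f₀, f₁, f₂, f₃, f₄, f₅⟩ := spec s₂ a₂ b₂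
    refine Emits.mono (emits_rep (M := α.code.h₁ - α.code.h₂) (by omega) ⟨f₀, f₂⟩ ?_ (by omega)
      fun s' a b => ?_) le_rfl (by simp [RamExpr.cost, fld])
    · simp only [RamExpr.eval, e₀, e₂]
    have := spec s' (a.trans a₂) fun i hi => (b i hi).trans (b₂ i hi)
    exact ⟨this.2.2.1, this.1.2.1⟩
  · replace a₃ := a₃.trans (a₂.trans a₁)
    replace b₃ := fun i hi => (b₃ i hi).trans ((b₂ i hi).trans (b₁ i hi))
    obtain ⟨⟨e₀, e₁, e₂, e₃, e₄, e₅⟩, f₀, f₁, f₂, f₃, f₄, f₅⟩ := spec s₃ a₃ b₃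
    refine Emits.mono (emits_rep (by omega) ⟨?_, f₀⟩ ?_ (by omega) fun s' a b => ?_) le_rfl
      (by simp [RamExpr.cost, fld])
    · simp only [RamExpr.Fits, reg0 s₃ b₃]
      omega
    · simp only [RamExpr.eval, reg0 s₃ b₃, e₀]
    · exact ⟨Nat.zero_le _, rfl⟩

/-- The minimum of two expressions. -/
def minExpr (a b : RamExpr) : RamExpr := .sub a (.sub a b)

/-- Is `s` at most the partial sum at `b` of the conjugate of the partition to which register `4`
points? -/
def testExpr (s b : RamExpr) : RamExpr :=
  .lt s (.add (.add (.add (.mul (fld 4 1) (minExpr (fld 4 0) b))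
    (.mul (fld 4 3) (minExpr (fld 4 2) b))) (.mul (fld 4 5) (minExpr (fld 4 4) b))) (.lit 1))

/-- The cell of the cross table for the object to which register `3` points and the conjugate of
the partition to which register `4` points. -/
def cellExpr : RamExpr :=
  .mul (testExpr (.mul (fld 3 1) (fld 3 0)) (fld 3 1))
    (.mul (testExpr (.add (.mul (fld 3 1) (fld 3 0)) (.mul (fld 3 3) (fld 3 2)))
        (.add (fld 3 1) (fld 3 3)))
      (testExpr (.add (.add (.mul (fld 3 1) (fld 3 0)) (.mul (fld 3 3) (fld 3 2)))
        (.mul (fld 3 5) (fld 3 4))) (.add (.add (fld 3 1) (fld 3 3)) (fld 3 5))))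

/-- The intermediate sums are bounded by a partial sum of the conjugate, hence by `n`, and fit into
a word. -/
theorem testExpr_spec {W n q x y : ℕ} {γ : Ptn n} {s : RamState} {a b : RamExpr} (hγ : γ ∈ J n)
    (h4 : s.reg 4 = q) (hc : codeAt s.mem q = γ.code) (hW : q + n + 5 ≤ W)
    (ha : a.Fits W s) (ha' : a.eval s = x) (hb : b.Fits W s) (hb' : b.eval s = y) :
    (testExpr a b).Fits W s ∧
      (testExpr a b).eval s = if x ≤ γ.conj.pre y then 1 else 0 := by
  obtain ⟨hj, hf⟩ := code_spec hγ
  obtain ⟨⟨e₀, e₁, e₂, e₃, e₄, e₅⟩, f₀, f₁, f₂, f₃, f₄, f₅⟩ := fld_spec h4 hc hj hW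
  have hpre := pre_conj_of_code hj hf y
  have hle := γ.conj.pre_le y
  have key : ∀ h : ℕ, h - (h - y) = min h y := fun h => by omega
  constructor
  · simp only [testExpr, minExpr, RamExpr.Fits, RamExpr.eval, e₀, e₁, e₂, e₃, e₄, e₅, f₀, f₁, f₂,
      f₃, f₄, f₅, ha, hb, hb', key, true_and, and_true]
    omega
  · simp only [testExpr, minExpr, RamExpr.eval, e₀, e₁, e₂, e₃, e₄, e₅, ha', hb', key]
    rw [← hpre]
    simp only [Nat.lt_succ_iff]

-- The product of the three tests is the conjunction in `le_iff_of_code`.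
open Classical in
theorem cellExpr_spec {W n p q : ℕ} {α γ : Ptn n} {s : RamState} (hα : α ∈ J n) (hγ : γ ∈ J n)
    (h3 : s.reg 3 = p) (hp : codeAt s.mem p = α.code) (h4 : s.reg 4 = q)
    (hq : codeAt s.mem q = γ.code) (hpW : p + n + 5 ≤ W) (hqW : q + n + 5 ≤ W) :
    cellExpr.Fits W s ∧ cellExpr.eval s = if α ≤ γ.conj then 1 else 0 := by
  obtain ⟨hj, hf⟩ := code_spec hα
  obtain ⟨⟨e₀, e₁, e₂, e₃, e₄, e₅⟩, f₀, f₁, f₂, f₃, f₄, f₅⟩ := fld_spec h3 hp hj hpW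
  have hl := hj.entries_le
  have hlen := hj.length_le
  have ht : _ = _ := hj.1
  rw [total] at ht
  obtain ⟨F₁, E₁⟩ := testExpr_spec (a := .mul (fld 3 1) (fld 3 0)) (b := fld 3 1)
    (x := α.code.m₁ * α.code.h₁) (y := α.code.m₁) hγ h4 hq hqW
    (by simp only [RamExpr.Fits, f₀, f₁, e₀, e₁, true_and]; omega)
    (by simp only [RamExpr.eval, e₀, e₁]) f₁ e₁
  obtain ⟨F₂, E₂⟩ := testExpr_spec
    (a := .add (.mul (fld 3 1) (fld 3 0)) (.mul (fld 3 3) (fld 3 2)))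
    (b := .add (fld 3 1) (fld 3 3))
    (x := α.code.m₁ * α.code.h₁ + α.code.m₂ * α.code.h₂) (y := α.code.m₁ + α.code.m₂) hγ h4 hq hqW
    (by simp only [RamExpr.Fits, RamExpr.eval, f₀, f₁, f₂, f₃, e₀, e₁, e₂, e₃, true_and]; omega)
    (by simp only [RamExpr.eval, e₀, e₁, e₂, e₃])
    (by simp only [RamExpr.Fits, f₁, f₃, e₁, e₃, true_and]; omega)
    (by simp only [RamExpr.eval, e₁, e₃])
  obtain ⟨F₃, E₃⟩ := testExpr_spec
    (a := .add (.add (.mul (fld 3 1) (fld 3 0)) (.mul (fld 3 3) (fld 3 2)))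
      (.mul (fld 3 5) (fld 3 4)))
    (b := .add (.add (fld 3 1) (fld 3 3)) (fld 3 5))
    (x := α.code.total) (y := α.code.m₁ + α.code.m₂ + α.code.m₃) hγ h4 hq hqW
    (by simp only [RamExpr.Fits, RamExpr.eval, f₀, f₁, f₂, f₃, f₄, f₅, e₀, e₁, e₂, e₃, e₄, e₅,
          true_and]; omega)
    (by simp only [RamExpr.eval, e₀, e₁, e₂, e₃, e₄, e₅, total])
    (by simp only [RamExpr.Fits, RamExpr.eval, f₁, f₃, f₅, e₁, e₃, e₅, true_and]; omega)
    (by simp only [RamExpr.eval, e₁, e₃, e₅])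
  have hle := le_iff_of_code (β := γ.conj) hj hf
  constructor
  · simp only [cellExpr, RamExpr.Fits, RamExpr.eval, F₁, F₂, F₃, E₁, E₂, E₃, true_and]
    split_ifs <;> omega
  · simp only [cellExpr, RamExpr.eval, E₁, E₂, E₃, hle]
    split_ifs <;> first | rfl | tauto

/-- Output the list of all join-irreducible partitions. -/
def outJ : RamProg := .seq (.emit (.reg 2)) (forEach 3 tupleProg)

/-- Output the standard context. -/
def outK : RamProg :=
  .seq outJ (.seq (.seq (.emit (.reg 2)) (forEach 3 conjProg))
    (forEach 3 (forEach 4 (.emit cellExpr))))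

theorem emits_list {W n : ℕ} {L : List (Ptn n)} {s : RamState} {p : RamProg}
    {f : Ptn n → List ℕ} (h2 : s.reg 2 = L.length)
    (hW : 6 * L.length + n + 6 ≤ W) (hp : ∀ (i : ℕ) (hi : i < L.length) (s' : RamState),
      s'.mem = s.mem → (∀ j < 3, s'.reg j = s.reg j) → s'.reg 3 = 6 * i →
      p.Emits W 4 s' (100 + 100 * n) (f L[i])) :
    (RamProg.seq (.emit (.reg 2)) (forEach 3 p)).Emits W 3 s
      (L.length * (100 + 100 * n + 10) + 10) (L.length :: L.flatMap f) := by
  have h := Emits.seq (T₂ := L.length * (100 + 100 * n + 10) + 8) (l₂ := L.flatMap f)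
    (emits_emit (W := W) (r := 3) (e := .reg 2) (s := s) (by change s.reg 2 ≤ W; omega))
    (q := forEach 3 p) fun s₁ a b => emits_forEach le_rfl ((b 2 (by omega)).trans h2) (by omega)
      fun i hi s' a' b' c' => hp i hi s' (a'.trans a) (fun j hj => (b' j hj).trans (b j hj)) c'
  have e : (RamExpr.reg 2).eval s = L.length := h2
  rw [e] at h
  exact h.mono le_rfl (by simp [RamExpr.cost]; omega)

theorem emits_outJ {W n : ℕ} {L : List (Ptn n)} {s : RamState} (hL : ∀ α ∈ L, α ∈ J n)
    (hs : s.reg 0 = n ∧ s.reg 2 = L.length ∧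
      ∀ (i : ℕ) (hi : i < L.length), codeAt s.mem (6 * i) = L[i].code)
    (hW : 6 * L.length + n + 6 ≤ W) :
    outJ.Emits W 3 s (L.length * (100 + 100 * n + 10) + 10) (L.length :: L.flatMap tuple) :=
  emits_list hs.2.1 hW fun i hi _ a b c => emits_tupleProg (hL _ (List.getElem_mem hi))
    ((b 0 (by omega)).trans hs.1) c (a ▸ hs.2.2 i hi) (by omega)

theorem cellExpr_cost : cellExpr.cost ≤ 400 := by
  simp [cellExpr, testExpr, minExpr, fld, RamExpr.cost]

/-- The attributes are never stored: the list of objects is traversed again, each record being read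
as its conjugate. -/
theorem emits_outK {W n : ℕ} {L : List (Ptn n)} {s : RamState} (hL : ∀ α ∈ L, α ∈ J n)
    (hs : s.reg 0 = n ∧ s.reg 2 = L.length ∧
      ∀ (i : ℕ) (hi : i < L.length), codeAt s.mem (6 * i) = L[i].code)
    (hW : 6 * L.length + n + 6 ≤ W) :
    outK.Emits W 3 s (2 * (L.length * (100 + 100 * n + 10) + 10) +
        (L.length * (L.length * 411 + 8 + 10) + 8))
      ((L.length :: L.flatMap tuple) ++ ((L.map conj).length :: (L.map conj).flatMap tuple) ++
        crossTable L (L.map conj)) := by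
  classical
  rw [List.append_assoc, List.length_map, List.flatMap_map, two_mul, Nat.add_assoc]
  refine Emits.seq (emits_outJ hL hs hW) fun s₁ a₁ b₁ => Emits.seq ?_ fun s₂ a₂ b₂ => ?_
  · refine emits_list ((b₁ 2 (by omega)).trans hs.2.1) hW fun i hi s' a b c =>
      emits_conjProg (hL _ (List.getElem_mem hi))
        ((b 0 (by omega)).trans ((b₁ 0 (by omega)).trans hs.1)) c ?_ (by omega)
    rw [a, a₁]
    exact hs.2.2 i hi
  · have hb : s₂.reg 2 = L.length := (b₂ 2 (by omega)).trans ((b₁ 2 (by omega)).trans hs.2.1)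
    refine emits_forEach le_rfl hb (by omega) fun i hi s₃ a₃ b₃ c₃ => ?_
    rw [show (L.map conj).map (fun β => if L[i] ≤ β then 1 else 0) =
      L.flatMap fun γ => [if L[i] ≤ γ.conj then 1 else 0] by
        rw [List.map_map, List.map_eq_flatMap]
        rfl]
    refine emits_forEach (by omega) ((b₃ 2 (by omega)).trans hb) (by omega)
      fun j hj s₄ a₄ b₄ c₄ => ?_
    have hm : s₄.mem = s.mem := a₄.trans (a₃.trans (a₂.trans a₁))
    obtain ⟨F, E⟩ := cellExpr_spec (W := W) (hL _ (List.getElem_mem hi))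
      (hL _ (List.getElem_mem hj)) ((b₄ 3 (by omega)).trans c₃) (hm ▸ hs.2.2 i hi) c₄
      (hm ▸ hs.2.2 j hj) (by omega) (by omega)
    rw [← E]
    exact (emits_emit F).mono le_rfl (Nat.succ_le_succ cellExpr_cost)

end RamProg

/-! ## Running times -/

/-- There are at most `n ^ 2` records of six words, so addresses up to about `6 * n ^ 2` must fit
into a word. -/
theorem wordBound_le {n : ℕ} : 6 * n ^ 2 + 10 * n + 30 ≤ wordBound 8 n := by
  have h : 3 ^ 6 ≤ (n + 2) ^ 6 ∨ n = 0 := by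
    rcases Nat.eq_zero_or_pos n with h | h
    · exact Or.inr h
    · exact Or.inl (Nat.pow_le_pow_left (by omega) 6)
  rcases h with h | rfl
  · rw [wordBound, show (n + 2) ^ 8 = (n + 2) ^ 6 * (n + 2) ^ 2 by ring]
    have := Nat.mul_le_mul_right ((n + 2) ^ 2) h
    nlinarith
  · norm_num [wordBound]

namespace Ptn

/-- There are at most quadratically many join-irreducible partitions. -/
theorem Lists.length_le_sq {n : ℕ} (hn : 1 ≤ n) {X : Set (Ptn n)} (hX : X ⊆ J n)
    {L : List (Ptn n)} (hL : Lists L X) : L.length ≤ n ^ 2 := by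
  rcases Nat.lt_or_ge n 3 with h | h
  · obtain ⟨L', h₁, h₂⟩ := exists_lists_initList (k := n) (by omega)
    have h₃ := congrArg List.length h₂
    have h₄ := hL.length_le h₁ hX
    rw [List.length_map] at h₃
    have h₅ : (initList n).length ≤ n ^ 2 := by interval_cases n <;> simp [initList]
    omega
  · obtain ⟨L', h₁, h₂, -⟩ := exists_lists_J h
    exact (hL.length_le h₁ hX).trans h₂

theorem Lists.sq_le_length {n : ℕ} (hn : 3 ≤ n) {L : List (Ptn n)} (hL : Lists L (J n)) :
    n ^ 2 ≤ 12 * L.length := by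
  obtain ⟨L', h₁, -, h₃⟩ := exists_lists_J hn
  rwa [hL.length_eq h₁]

theorem length_flatMap_const {α β : Type*} (L : List α) (f : α → List β) (c : ℕ)
    (h : ∀ x ∈ L, (f x).length = c) : (L.flatMap f).length = L.length * c := by
  induction L with
  | nil => simp
  | cons x L ih =>
    rw [List.flatMap_cons, List.length_append, h x List.mem_cons_self,
      ih fun y hy => h y (List.mem_cons_of_mem _ hy), List.length_cons, Nat.succ_mul, add_comm]

end Ptn

theorem IsJOutput.le_length {n : ℕ} (hn : 3 ≤ n) {o : List ℕ} (h : IsJOutput n o) :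
    n ^ 3 ≤ 144 * o.length := by
  obtain ⟨L, hL, rfl⟩ := h
  have h₁ := hL.sq_le_length hn
  rw [List.length_cons, length_flatMap_const L tuple n fun α _ => by simp [tuple]]
  nlinarith

/-- Conjugation makes both lists equally long, so the table alone has at least `(n ^ 2 / 12) ^ 2`
cells. -/
theorem IsContextOutput.le_length {n : ℕ} (hn : 3 ≤ n) {o : List ℕ} (h : IsContextOutput n o) :
    n ^ 4 ≤ 144 * o.length := by
  obtain ⟨G, A, hG, hA, rfl⟩ := h
  have h₁ := hG.sq_le_length hn
  have h₂ : A.length = G.length := by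
    rw [hA.length_eq hG.map_conj, List.length_map]
  have h₃ : (crossTable G A).length = G.length * G.length := by
    rw [crossTable, length_flatMap_const _ _ A.length fun α _ => by simp, h₂]
  rw [List.length_append, h₃]
  have h₄ := Nat.mul_le_mul h₁ h₁
  nlinarith

theorem isInit_initProg : IsInit 8 initProg.size initProg := by
  intro n hn
  have hW := wordBound_le (n := n)
  obtain ⟨L, hL, hC⟩ := exists_lists_initList (k := min n 3) (min_le_right _ _)
  obtain ⟨t, s, h₁, h₂, h₃⟩ := (wp_initProg hn (by omega) (by omega) :
    initProg.Wp (wordBound 8 n) _ _).runs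
  exact ⟨L, t, s, hL, h₁, h₂, holds_iff.2 (hC ▸ h₃)⟩

theorem isRecStep_stepProg : IsRecStep 8 stepTime stepProg := by
  intro n k hk hkn X L s hX hL hs
  have hW := wordBound_le (n := n)
  have hlen := hL.length_le_sq (by omega) hX
  have hsq : k ^ 2 ≤ n ^ 2 := Nat.pow_le_pow_left hkn.le 2
  obtain ⟨L', h₁, h₂⟩ := exists_lists_recStep hk hX hL
  obtain ⟨t, s', h₃, h₄, h₅⟩ := runs_stepProg (W := wordBound 8 n) hk hkn.le (C := L.map code)
    (fun c hc => by
      obtain ⟨α, hα, rfl⟩ := List.mem_map.1 hc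
      exact (code_spec (hX ((hL.2 α).1 hα))).1)
    (by rwa [List.length_map]) (by rw [List.length_map]; omega) (holds_iff.1 hs)
  exact ⟨L', t, s', h₁, h₃, h₄, holds_iff.2 (h₂ ▸ h₅)⟩

/-- The loop that computes a list of the join-irreducible partitions of `n`, followed by a program
that works with this list. -/
theorem runs_iterProg {d c₁ c₂ n T : ℕ} {init step fin : RamProg} {Q : RamState → Prop}
    (hi : IsInit d c₁ init) (hs : IsRecStep d c₂ step) (hn : 1 ≤ n) (hW : n + 1 ≤ wordBound d n)
    (hfin : ∀ (L : List (Ptn n)) (s : RamState), Lists L (J n) → Holds n n L s →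
      fin.Runs (wordBound d n) s T Q) :
    (iterProg init step fin).Runs (wordBound d n) (ramInput n)
      (c₁ + ((n * (4 + c₂ * n ^ 2) + 4) + T)) Q := by
  obtain ⟨L₀, t₀, s₀, hL₀, h₀, ht₀, hh₀⟩ := hi n hn
  -- The type of the list depends on `k`, which is therefore quantified inside the invariant and
  -- tied to the round `i`. For `n ≤ 3` there are no rounds.
  let I : ℕ → RamState → Prop := fun i s => ∃ k, k = min n 3 + i ∧
    ∃ L : List (Ptn k), Lists L (J k) ∧ Holds n k L s
  have hinit : init.Runs (wordBound d n) (ramInput n) c₁ (I 0) :=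
    ⟨t₀, s₀, h₀, ht₀, _, rfl, L₀, hL₀, hh₀⟩
  refine Runs.mono (Runs.seq hinit fun s hI => Runs.seq (T₂ := T)
    (Runs.loop I (n - min n 3) (c₂ * n ^ 2) ?_ ?_ hI) fun s' hs' => ?_) ?_ fun _ h => h
  · rintro i hin s ⟨k, rfl, L, hL, hh⟩
    have hlt : min n 3 + i < n := by omega
    obtain ⟨L', t, s', hL', he, ht, hh'⟩ := hs n (min n 3 + i) (by omega) hlt _ L s subset_rfl hL hh
    rw [recStep_J (by omega)] at hL'
    refine ⟨?_, ?_, t, s', he, ht.trans ?_, _, rfl, L', hL', hh'⟩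
    · simp only [RamExpr.Fits, hh.1, hh.2.1]
      omega
    · simp only [RamExpr.eval, hh.1, hh.2.1, if_pos hlt]
      exact one_ne_zero
    · exact Nat.mul_le_mul_left _ (Nat.pow_le_pow_left hlt.le 2)
  · rintro s ⟨k, rfl, L, hL, hh⟩
    simp only [RamExpr.Fits, RamExpr.eval, hh.1, hh.2.1]
    rw [if_neg (by omega)]
    omega
  · obtain ⟨k, hk, L, hL, hh⟩ := hs'
    obtain rfl : k = n := by omega
    exact hfin L s' hL hh
  · have := Nat.mul_le_mul_right (4 + c₂ * n ^ 2) (Nat.sub_le n (min n 3))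
    simp only [RamExpr.cost, Nat.reduceAdd]
    omega

/-- An upper bound for the time and a lower bound for the length of the output give a `Θ`. -/
theorem runsInTheta_of_le {d e C C' : ℕ} {p : RamProg} {Good : ℕ → List ℕ → Prop}
    (h : ∀ n, 1 ≤ n → p.Runs (wordBound d n) (ramInput n) (C * n ^ e) fun s => Good n s.out)
    (h' : ∀ n, 3 ≤ n → ∀ o, Good n o → n ^ e ≤ C' * o.length) : RunsInTheta d p Good e := by
  -- `T` has to be total; its value at `0` plays no role.
  have h₁ : ∀ n, ∃ t, 1 ≤ n → (∃ s, Exec (wordBound d n) p (ramInput n) t s ∧ Good n s.out) ∧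
      t ≤ C * n ^ e := fun n => by
    by_cases hn : 1 ≤ n
    · obtain ⟨t, s, h₁, h₂, h₃⟩ := h n hn
      exact ⟨t, fun _ => ⟨⟨s, h₁, h₃⟩, h₂⟩⟩
    · exact ⟨0, fun h => absurd h hn⟩
  choose T hT using h₁
  refine ⟨T, fun n hn => (hT n hn).1, ?_, ?_⟩
  · refine IsBigO.of_bound (C : ℝ) (eventually_atTop.2 ⟨1, fun n hn => ?_⟩)
    rw [Real.norm_of_nonneg (by positivity), Real.norm_of_nonneg (by positivity)]
    exact_mod_cast (hT n hn).2
  · refine IsBigO.of_bound (C' : ℝ) (eventually_atTop.2 ⟨3, fun n hn => ?_⟩)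
    rw [Real.norm_of_nonneg (by positivity), Real.norm_of_nonneg (by positivity)]
    obtain ⟨⟨s, h₁, h₂⟩, -⟩ := hT n (by omega)
    -- The lower half of the `Θ`: the time is at least the length of the output.
    have h₃ := h₁.out_length_le
    simp only [ramInput, List.length_nil, Nat.zero_add] at h₃
    exact_mod_cast (h' n hn _ h₂).trans (Nat.mul_le_mul_left C' h₃)

theorem runsInTheta_outJ : RunsInTheta 8 (iterProg initProg stepProg outJ) IsJOutput 3 := by
  refine runsInTheta_of_le (C := initProg.size + stepTime + 300) (C' := 144) (fun n hn => ?_)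
    fun n hn o ho => ho.le_length hn
  have hW := wordBound_le (n := n)
  refine (runs_iterProg (T := n ^ 2 * (100 + 100 * n + 10) + 10) isInit_initProg
    isRecStep_stepProg hn (by omega) fun L s hL hs => ?_).mono ?_ fun _ h => h
  · have hlen := hL.length_le_sq hn subset_rfl
    have hs' := holds_iff.1 hs
    refine Runs.mono (emits_outJ (fun α hα => (hL.2 α).1 hα) ⟨hs.1, hs.2.2.1, fun i hi => ?_⟩
      (by omega)) ?_ ?_
    · rw [hs'.2.2.2.2 i (by simpa using hi), List.getElem_map]
    · exact Nat.add_le_add_right (Nat.mul_le_mul_right _ hlen) _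
    · rintro s' ⟨-, h, -⟩
      rw [hs.2.2.2.1] at h
      exact ⟨L, hL, h⟩
  · have e₁ : n ≤ n ^ 3 := Nat.le_self_pow (by omega) n
    have e₂ : n ^ 2 ≤ n ^ 3 := Nat.pow_le_pow_right hn (by omega)
    have e₃ : initProg.size * 1 ≤ initProg.size * n ^ 3 := Nat.mul_le_mul_left _ (by omega)
    have e₄ : n * (4 + stepTime * n ^ 2) = 4 * n + stepTime * n ^ 3 := by ring
    have e₅ : n ^ 2 * (100 + 100 * n + 10) = 110 * n ^ 2 + 100 * n ^ 3 := by ring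
    rw [e₄, e₅, Nat.add_mul, Nat.add_mul]
    omega

theorem runsInTheta_outK : RunsInTheta 8 (iterProg initProg stepProg outK) IsContextOutput 4 := by
  refine runsInTheta_of_le (C := initProg.size + stepTime + 1000) (C' := 144) (fun n hn => ?_)
    fun n hn o ho => ho.le_length hn
  have hW := wordBound_le (n := n)
  refine (runs_iterProg (T := 2 * (n ^ 2 * (100 + 100 * n + 10) + 10) +
    (n ^ 2 * (n ^ 2 * 411 + 8 + 10) + 8)) isInit_initProg
    isRecStep_stepProg hn (by omega) fun L s hL hs => ?_).mono ?_ fun _ h => h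
  · have hlen := hL.length_le_sq hn subset_rfl
    have hs' := holds_iff.1 hs
    refine Runs.mono (emits_outK (fun α hα => (hL.2 α).1 hα) ⟨hs.1, hs.2.2.1, fun i hi => ?_⟩
      (by omega)) ?_ ?_
    · rw [hs'.2.2.2.2 i (by simpa using hi), List.getElem_map]
    · gcongr
    · rintro s' ⟨-, h, -⟩
      rw [hs.2.2.2.1] at h
      exact ⟨L, L.map conj, hL, hL.map_conj, h⟩
  · have e₁ : n ≤ n ^ 4 := Nat.le_self_pow (by omega) n
    have e₂ : n ^ 2 ≤ n ^ 4 := Nat.pow_le_pow_right hn (by omega)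
    have e₃ : initProg.size * 1 ≤ initProg.size * n ^ 4 := Nat.mul_le_mul_left _ (by omega)
    have e₆ : n ^ 3 ≤ n ^ 4 := Nat.pow_le_pow_right hn (by omega)
    have e₇ := Nat.mul_le_mul_left stepTime e₆
    have e₄ : n * (4 + stepTime * n ^ 2) = 4 * n + stepTime * n ^ 3 := by ring
    have e₅ : n ^ 2 * (100 + 100 * n + 10) = 110 * n ^ 2 + 100 * n ^ 3 := by ring
    have e₈ : n ^ 2 * (n ^ 2 * 411 + 8 + 10) = 411 * n ^ 4 + 18 * n ^ 2 := by ring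
    rw [e₄, e₅, e₈, Nat.add_mul, Nat.add_mul]
    omega

theorem mainTheorem6 :
    (∃ (d c : ℕ) (init step outJ outK : RamProg),
      IsInit d c init ∧ IsRecStep d c step ∧
      RunsInTheta d (iterProg init step outJ) IsJOutput 3 ∧
      RunsInTheta d (iterProg init step outK) IsContextOutput 4) ∧
    (∃ c : ℝ, 0 < c ∧ ∀ᶠ n : ℕ in atTop, ∀ (W : ℕ) (p : RamProg) (t : ℕ) (s : RamState),
      Exec W p (ramInput n) t s → IsContextOutput n s.out → c * (n : ℝ) ^ 4 ≤ t) := by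
  -- One constant serves both `init` and `step`, hence the sum; `144` is the square of the `12` in
  -- the count of `J`.
  refine ⟨⟨8, initProg.size + stepTime, initProg, stepProg, outJ, outK, fun n hn => ?_,
    fun n k hk hkn X L s hX hL hs => ?_, runsInTheta_outJ, runsInTheta_outK⟩, 1 / 144,
    by norm_num, eventually_atTop.2 ⟨3, fun n hn W p t s he ho => ?_⟩⟩
  · obtain ⟨L, t, s, h₁, h₂, h₃, h₄⟩ := isInit_initProg n hn
    exact ⟨L, t, s, h₁, h₂, by omega, h₄⟩
  · obtain ⟨L', t, s', h₁, h₂, h₃, h₄⟩ := isRecStep_stepProg n k hk hkn X L s hX hL hs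
    exact ⟨L', t, s', h₁, h₂, h₃.trans (Nat.mul_le_mul_right _ (by omega)), h₄⟩
  · have h₁ := he.out_length_le
    simp only [ramInput, List.length_nil, Nat.zero_add] at h₁
    have h₂ : ((n ^ 4 : ℕ) : ℝ) ≤ ((144 * t : ℕ) : ℝ) :=
      Nat.cast_le.2 ((ho.le_length hn).trans (Nat.mul_le_mul_left 144 h₁))
    push_cast at h₂
    linarith
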